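/- Conventions. A dagger category is a category with an operation $f\mapsto f^\dagger$ sending $f\colon X\to Y$ to $f^\dagger\colon Y\to X$ such that $\mathrm{id}^\dagger=\mathrm{id}$, $f^{\dagger\dagger}=f$ and $(f\circ g)^\dagger=g^\dagger\circ f^\dagger$. A morphism $m$ is dagger monic if $m^\dagger\circ m=\mathrm{id}$, and a dagger isomorphism if it is invertible with $m^{-1}=m^\dagger$. A dagger symmetric monoidal category is a dagger category with a symmetric monoidal structure $(\otimes,I)$ such that $(f\otimes g)^\dagger=f^\dagger\otimes g^\dagger$ and the associators, unitors and braidings $\beta$ are dagger isomorphisms. It is dagger compact closed if for every object $X$ there are an object $X^*$ and a morphism $\eta\colon I\to X^*\otimes X$ such that $\eta$ and $\varepsilon=\eta^\dagger\circ\beta_{X,X^*}\colon X\otimes X^*\to I$ satisfy the two triangle identities. A dagger biproduct of a family $(X_m)_{m\in M}$ is an object with projections $p_m$ and injections $i_m$ making it both a product and a coproduct of the family, with $p_m\circ i_m=\mathrm{id}$, $p_m\circ i_n=0$ for $m\neq n$, and $p_m=i_m^\dagger$. A dagger kernel is a dagger monic morphism that is a kernel of some morphism; for a dagger kernel $k$,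 $k^\perp$ denotes a dagger monic kernel of $k^\dagger$. $\mathbf{Rel}$ is the category of sets and binary relations with the converse as dagger, the Cartesian product as $\otimes$, and a one-element set $\{*\}$ as unit. Theorem. Let $(\mathbf C,\otimes,I,\dagger)$ be a (locally small) dagger compact closed category such that 1. each (set-indexed) family of objects has a dagger biproduct; 2. each morphism has a kernel that is dagger monic; 3. $k$ and $k^\perp$ are jointly epic for each dagger kernel $k$, i.e. $f=g$ whenever $f\circ k=g\circ k$ and $f\circ k^\perp=g\circ k^\perp$; 4. $I$ is not a zero object; 5. each nonzero morphism $I\to I$ is invertible; 6. $I$ is a separator, i.e. the morphisms $I\to X$ are jointly epic for each object $X$. For a family of morphisms $r_m\colon X\to Y$ $(m \in M)$ put $\sum_m r_m=\Delta_Y^\dagger\circ\bigl(\bigoplus_m r_m\bigr)\circ\Delta_X$, where $\Delta_X\colon X\to\bigoplus_m X$ and $\Delta_Y\colon Y\to\bigoplus_m Y$ are the diagonals, and order $\mathbf C(X,Y)$ by $r\le s\iff r+s=s$. An atom of $\mathbf C(I,X)$ is a nonzero $a\colon I\to X$ such that every $b\le a$ is $0$ or $a$. Let $E(X)$ be the set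 of atoms of $\mathbf C(I,X)$ and, for $r\colon X\to Y$, let $E(r)=\{(x,y)\in E(X)\times E(Y)\mid y^\dagger\circ r\circ x=\mathrm{id}_I\}$. Then $E$ is a functor $\mathbf C\to\mathbf{Rel}$, and it is a strong symmetric monoidal dagger equivalence: it is full and faithful, $E(r^\dagger)=E(r)^\dagger$ for all $r$, every set is dagger isomorphic to some $E(X)$, and $E$ is a strong symmetric monoidal functor $(\mathbf C,\otimes,I)\to(\mathbf{Rel},\times,\{*\})$ whose coherence isomorphisms are the dagger isomorphisms $\{*\}\to E(I)$, $*\mapsto \mathrm{id}_I$, and $E(X)\times E(Y)\to E(X\otimes Y)$, $(x,y)\mapsto (x\otimes y)\circ\lambda_I^{-1}$ (where $\lambda_I\colon I\otimes I\to I$ is the unitor). Conversely, $\mathbf{Rel}$ is a dagger compact closed category satisfying (1)-(6). -/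

import Mathlib

open CategoryTheory CategoryTheory.Limits CategoryTheory.MonoidalCategory

universe v u

/-- A dagger category: every morphism `f : X ⟶ Y` has an adjoint `dagger f : Y ⟶ X`, and `dagger`
is an involutive, identity-on-objects, contravariant functor. -/
class DaggerCategory (C : Type u) [Category.{v} C] where
  dagger : ∀ {X Y : C}, (X ⟶ Y) → (Y ⟶ X)
  dagger_id : ∀ X : C, dagger (𝟙 X) = 𝟙 X
  dagger_dagger : ∀ {X Y : C} (f : X ⟶ Y), dagger (dagger f) = f
  dagger_comp : ∀ {X Y Z : C} (f : X ⟶ Y) (g : Y ⟶ Z), dagger (f ≫ g) = dagger g ≫ dagger f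

postfix:max "‡" => DaggerCategory.dagger

section DaggerNotions

variable {C : Type u} [Category.{v} C] [DaggerCategory C]

/-- A dagger monomorphism. -/
def IsDaggerMono {X Y : C} (m : X ⟶ Y) : Prop := m ≫ m‡ = 𝟙 X

/-- A dagger isomorphism: the inverse is the dagger. -/
def IsDaggerIso {X Y : C} (m : X ⟶ Y) : Prop := m ≫ m‡ = 𝟙 X ∧ m‡ ≫ m = 𝟙 Y

/-- A dagger symmetric monoidal category: a dagger category with a symmetric monoidal structure
whose product is a dagger functor and whose associators, unitors and braidings are dagger
isomorphisms. -/
class IsDaggerSymmetricMonoidal (C : Type u) [Category.{v} C] [DaggerCategory C]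
    [MonoidalCategory C] [SymmetricCategory C] : Prop where
  dagger_tensorHom : ∀ {X₁ Y₁ X₂ Y₂ : C} (f : X₁ ⟶ Y₁) (g : X₂ ⟶ Y₂),
    (f ⊗ₘ g)‡ = f‡ ⊗ₘ g‡
  associator : ∀ X Y Z : C, IsDaggerIso (α_ X Y Z).hom
  leftUnitor : ∀ X : C, IsDaggerIso (λ_ X).hom
  rightUnitor : ∀ X : C, IsDaggerIso (ρ_ X).hom
  braiding : ∀ X Y : C, IsDaggerIso (β_ X Y).hom

/-- `D` is a dagger dual of `X`: there is `η : I ⟶ D ⊗ X` such that `η` and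
`ε = η‡ ∘ β : X ⊗ D ⟶ I` satisfy the two triangle identities. -/
def IsDaggerDual [MonoidalCategory C] [SymmetricCategory C] (X D : C) : Prop :=
  ∃ p : ExactPairing D X, p.evaluation' = (β_ X D).hom ≫ (p.coevaluation')‡

/-- A dagger compact closed category: a dagger symmetric monoidal category in which every object
has a dagger dual. -/
class IsDaggerCompactClosed (C : Type u) [Category.{v} C] [DaggerCategory C]
    [MonoidalCategory C] [SymmetricCategory C] : Prop extends IsDaggerSymmetricMonoidal C where
  exists_dual : ∀ X : C, ∃ D : C, IsDaggerDual X D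

/-- A functor that preserves daggers. -/
def IsDaggerFunctor {D : Type*} [Category* D] [DaggerCategory D] (F : C ⥤ D) : Prop :=
  ∀ {X Y : C} (f : X ⟶ Y), F.map (f‡) = (F.map f)‡

/-- A dagger equivalence: a full and faithful dagger functor such that every object of the
codomain is dagger isomorphic to one in the image. -/
structure IsDaggerEquivalence {D : Type*} [Category* D] [DaggerCategory D] (F : C ⥤ D) :
    Prop where
  isDagger : IsDaggerFunctor F
  full : F.Full
  faithful : F.Faithful
  essSurj : ∀ Y : D, ∃ (X : C) (i : F.obj X ⟶ Y), IsDaggerIso i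

variable [HasZeroMorphisms C]

/-- A dagger biproduct of a family of objects: a biproduct (simultaneously a product and a
coproduct, with `ι i ≫ π j` the identity for `i = j` and zero otherwise) whose projections are the
daggers of its injections. -/
structure DaggerBiproduct {M : Type*} (f : M → C) where
  bicone : Bicone f
  isBilimit : bicone.IsBilimit
  π_eq : ∀ m, bicone.π m = (bicone.ι m)‡

/-- `k` is a kernel of `f`. -/
def IsKernelOf {A X Y : C} (k : A ⟶ X) (f : X ⟶ Y) : Prop :=
  ∃ w : k ≫ f = 0, Nonempty (IsLimit (KernelFork.ofι k w))

/-- A dagger kernel: a dagger monomorphism that is a kernel of some morphism. -/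
def IsDaggerKernel {A X : C} (k : A ⟶ X) : Prop :=
  IsDaggerMono k ∧ ∃ (Y : C) (f : X ⟶ Y), IsKernelOf k f

/-- `k'` is a complement `k^⊥ = ker (k‡)` of `k`, the kernel being taken dagger monic. -/
def IsDaggerComplement {A A' X : C} (k' : A' ⟶ X) (k : A ⟶ X) : Prop :=
  IsDaggerMono k' ∧ IsKernelOf k' (k‡)

/-- Two morphisms with the same codomain are jointly epic. -/
def JointlyEpic {A A' X : C} (k : A ⟶ X) (k' : A' ⟶ X) : Prop :=
  ∀ {Y : C} (f g : X ⟶ Y), k ≫ f = k ≫ g → k' ≫ f = k' ≫ g → f = g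

variable (C) in
/-- Every family of objects, indexed by a set, has a dagger biproduct. -/
def HasDaggerBiproducts : Prop :=
  ∀ (M : Type v) (f : M → C), Nonempty (DaggerBiproduct f)

/-- The six hypotheses on a dagger compact closed category. -/
structure RelAxioms (C : Type u) [Category.{v} C] [DaggerCategory C] [HasZeroMorphisms C]
    [MonoidalCategory C] : Prop where
  biproducts : HasDaggerBiproducts C
  kernels : ∀ {X Y : C} (f : X ⟶ Y), ∃ (A : C) (k : A ⟶ X), IsKernelOf k f ∧ IsDaggerMono k
  jointlyEpic : ∀ {A A' X : C} (k : A ⟶ X) (k' : A' ⟶ X),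
    IsDaggerKernel k → IsDaggerComplement k' k → JointlyEpic k k'
  unit_nonzero : ¬ IsZero (𝟙_ C)
  scalar_invertible : ∀ s : 𝟙_ C ⟶ 𝟙_ C, s ≠ 0 → IsIso s
  separator : IsSeparator (𝟙_ C)

end DaggerNotions

noncomputable section AtomFunctor

variable {C : Type u} [Category.{v} C] [DaggerCategory C] [HasZeroMorphisms C]

/-- The diagonal morphism `Y ⟶ ⨁_{m ∈ M} Y` into a dagger biproduct of copies of `Y`. -/
def DaggerBiproduct.diag {M : Type*} {Y : C} (B : DaggerBiproduct fun _ : M => Y) :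
    Y ⟶ B.bicone.pt :=
  B.isBilimit.isLimit.lift (Fan.mk Y fun _ => 𝟙 Y)

/-- The morphism `⨁ r_m : ⨁ X_m ⟶ ⨁ Y_m` between dagger biproducts. -/
def DaggerBiproduct.map {M : Type*} {X Y : M → C} (A : DaggerBiproduct X) (B : DaggerBiproduct Y)
    (r : ∀ m, X m ⟶ Y m) : A.bicone.pt ⟶ B.bicone.pt :=
  B.isBilimit.isLimit.lift (Fan.mk A.bicone.pt fun m => A.bicone.π m ≫ r m)

/-- The sum `∑ r_m = Δ‡ ∘ (⨁ r_m) ∘ Δ` of a family of parallel morphisms. It does not depend on the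
chosen biproducts. -/
def homSum (h : HasDaggerBiproducts C) {M : Type v} {X Y : C} (r : M → (X ⟶ Y)) : X ⟶ Y :=
  (h M fun _ => X).some.diag ≫ (h M fun _ => X).some.map (h M fun _ => Y).some r ≫
    ((h M fun _ => Y).some.diag)‡

/-- The sum of two parallel morphisms. -/
def homAdd (h : HasDaggerBiproducts C) {X Y : C} (r s : X ⟶ Y) : X ⟶ Y :=
  homSum h fun b : ULift.{v} Bool => if b.down then r else s

/-- The order on morphisms: `r ≤ s` when `r + s = s`. -/
def homLE (h : HasDaggerBiproducts C) {X Y : C} (r s : X ⟶ Y) : Prop :=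
  homAdd h r s = s

/-- An atom of a hom set: a minimal nonzero morphism. -/
def IsHomAtom (h : HasDaggerBiproducts C) {X Y : C} (a : X ⟶ Y) : Prop :=
  a ≠ 0 ∧ ∀ b : X ⟶ Y, homLE h b a → b = 0 ∨ b = a

variable [MonoidalCategory C]

/-- The set `E(X)` of atoms of `C(I, X)`. -/
def AtomObj (h : HasDaggerBiproducts C) (X : C) : RelCat.{v} :=
  {a : 𝟙_ C ⟶ X // IsHomAtom h a}

/-- The underlying morphism of an element of `E(X)`. -/
def AtomObj.mor {h : HasDaggerBiproducts C} {X : C} (a : AtomObj h X) : 𝟙_ C ⟶ X :=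
  Subtype.val a

/-- The relation `E(r) = {(x, y) | y‡ ∘ r ∘ x = 1}`. -/
def atomMap (h : HasDaggerBiproducts C) {X Y : C} (r : X ⟶ Y) : AtomObj h X ⟶ AtomObj h Y :=
  RelCat.Hom.ofRel {p | p.1.mor ≫ r ≫ (p.2.mor)‡ = 𝟙 (𝟙_ C)}

/-- The assignment `E` is functorial. -/
structure AtomFunctorial (h : HasDaggerBiproducts C) : Prop where
  map_id : ∀ X : C, atomMap h (𝟙 X) = 𝟙 (AtomObj h X)
  map_comp : ∀ {X Y Z : C} (r : X ⟶ Y) (s : Y ⟶ Z),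
    atomMap h (r ≫ s) = atomMap h r ≫ atomMap h s

/-- The functor `E`. -/
def atomFunctor (h : HasDaggerBiproducts C) (hE : AtomFunctorial h) : C ⥤ RelCat.{v} where
  obj := AtomObj h
  map := atomMap h
  map_id := hE.map_id
  map_comp := hE.map_comp

end AtomFunctor

section Rel

/-- The dagger of a relation is its converse. -/
instance RelCat.instDaggerCategory : DaggerCategory RelCat.{v} where
  dagger r := RelCat.Hom.ofRel {p | (p.2, p.1) ∈ r.rel}
  dagger_id X := by
    ext ⟨x, y⟩
    exact ⟨fun h => Eq.symm h, fun h => Eq.symm h⟩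
  dagger_dagger _ := rfl
  dagger_comp r s := by
    ext ⟨x, y⟩
    exact ⟨fun ⟨z, h₁, h₂⟩ => ⟨z, h₂, h₁⟩, fun ⟨z, h₁, h₂⟩ => ⟨z, h₂, h₁⟩⟩

/-- The zero morphisms of the category of relations are the empty relations. -/
instance RelCat.instHasZeroMorphisms : HasZeroMorphisms RelCat.{v} where
  zero X Y := ⟨RelCat.Hom.ofRel ∅⟩
  comp_zero r Z := by
    ext ⟨x, y⟩
    exact ⟨fun ⟨_, _, h⟩ => h.elim, fun h => h.elim⟩
  zero_comp X {Y Z} r := by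
    ext ⟨x, y⟩
    exact ⟨fun ⟨_, h, _⟩ => h.elim, fun h => h.elim⟩

/-- The isomorphism of the category of relations given by (the graph of) a bijection. -/
def RelCat.isoOfEquiv {X Y : Type v} (e : X ≃ Y) :
    Iso (C := RelCat.{v}) X Y where
  hom := RelCat.Hom.ofRel {p | e p.1 = p.2}
  inv := RelCat.Hom.ofRel {p | e p.2 = p.1}
  hom_inv_id := by
    ext ⟨x, y⟩
    exact ⟨fun ⟨_, h₁, h₂⟩ => e.injective (h₁.trans h₂.symm),
      fun h => ⟨e x, rfl, congrArg e (Eq.symm h)⟩⟩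
  inv_hom_id := by
    ext ⟨x, y⟩
    exact ⟨fun ⟨_, h₁, h₂⟩ => h₁.symm.trans h₂,
      fun h => ⟨e.symm x, e.apply_symm_apply x, (e.apply_symm_apply x).trans h⟩⟩

/-- The data of the monoidal structure on the category of relations: the Cartesian product of sets,
the product of relations, a one-element set, and the usual bijections. -/
instance RelCat.instMonoidalCategoryStruct : MonoidalCategoryStruct RelCat.{v} where
  tensorObj X Y := @Prod.{v, v} X Y
  whiskerLeft _ {_ _} r := RelCat.Hom.ofRel {p | p.1.1 = p.2.1 ∧ (p.1.2, p.2.2) ∈ r.rel}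
  whiskerRight {_ _} r _ := RelCat.Hom.ofRel {p | (p.1.1, p.2.1) ∈ r.rel ∧ p.1.2 = p.2.2}
  tensorHom r s := RelCat.Hom.ofRel {p | (p.1.1, p.2.1) ∈ r.rel ∧ (p.1.2, p.2.2) ∈ s.rel}
  tensorUnit := PUnit.{v + 1}
  associator X Y Z := RelCat.isoOfEquiv (Equiv.prodAssoc X Y Z)
  leftUnitor X := RelCat.isoOfEquiv (Equiv.punitProd X)
  rightUnitor X := RelCat.isoOfEquiv (Equiv.prodPUnit X)

instance RelCat.instMonoidalCategory : MonoidalCategory RelCat.{v} where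
  tensorHom_def r s := by
    ext ⟨⟨x₁, x₂⟩, ⟨y₁, y₂⟩⟩
    constructor
    · rintro ⟨h₁, h₂⟩
      exact ⟨(y₁, x₂), ⟨h₁, rfl⟩, ⟨rfl, h₂⟩⟩
    · rintro ⟨⟨z₁, z₂⟩, ⟨h₁, h₂⟩, ⟨h₃, h₄⟩⟩
      obtain rfl : x₂ = z₂ := h₂
      obtain rfl : z₁ = y₁ := h₃
      exact ⟨h₁, h₄⟩
  id_tensorHom_id X Y := by
    ext ⟨⟨x₁, x₂⟩, ⟨y₁, y₂⟩⟩
    exact ⟨fun ⟨h₁, h₂⟩ => Prod.ext h₁ h₂, fun h => ⟨congrArg Prod.fst h, congrArg Prod.snd h⟩⟩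
  tensorHom_comp_tensorHom r₁ r₂ s₁ s₂ := by
    ext ⟨⟨x₁, x₂⟩, ⟨z₁, z₂⟩⟩
    constructor
    · rintro ⟨⟨y₁, y₂⟩, ⟨h₁, h₂⟩, ⟨h₃, h₄⟩⟩
      exact ⟨⟨y₁, h₁, h₃⟩, ⟨y₂, h₂, h₄⟩⟩
    · rintro ⟨⟨y₁, h₁, h₃⟩, ⟨y₂, h₂, h₄⟩⟩
      exact ⟨⟨y₁, y₂⟩, ⟨h₁, h₂⟩, ⟨h₃, h₄⟩⟩
  whiskerLeft_id X Y := by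
    ext ⟨⟨x₁, x₂⟩, ⟨y₁, y₂⟩⟩
    exact ⟨fun ⟨h₁, h₂⟩ => Prod.ext h₁ h₂, fun h => ⟨congrArg Prod.fst h, congrArg Prod.snd h⟩⟩
  id_whiskerRight X Y := by
    ext ⟨⟨x₁, x₂⟩, ⟨y₁, y₂⟩⟩
    exact ⟨fun ⟨h₁, h₂⟩ => Prod.ext h₁ h₂, fun h => ⟨congrArg Prod.fst h, congrArg Prod.snd h⟩⟩
  associator_naturality r₁ r₂ r₃ := by
    ext ⟨⟨⟨x₁, x₂⟩, x₃⟩, ⟨y₁, y₂, y₃⟩⟩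
    constructor
    · rintro ⟨⟨⟨z₁, z₂⟩, z₃⟩, ⟨⟨h₁, h₂⟩, h₃⟩, h⟩
      cases (show (z₁, z₂, z₃) = (y₁, y₂, y₃) from h)
      exact ⟨(x₁, x₂, x₃), rfl, h₁, h₂, h₃⟩
    · rintro ⟨⟨z₁, z₂, z₃⟩, h, h₁, h₂, h₃⟩
      cases (show (x₁, x₂, x₃) = (z₁, z₂, z₃) from h)
      exact ⟨((y₁, y₂), y₃), ⟨⟨h₁, h₂⟩, h₃⟩, rfl⟩
  leftUnitor_naturality r := by
    ext ⟨⟨u, x⟩, y⟩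
    constructor
    · rintro ⟨⟨u', z⟩, ⟨_, h⟩, h'⟩
      cases (show z = y from h')
      exact ⟨x, rfl, h⟩
    · rintro ⟨z, h', h⟩
      cases (show x = z from h')
      exact ⟨(u, y), ⟨rfl, h⟩, rfl⟩
  rightUnitor_naturality r := by
    ext ⟨⟨x, u⟩, y⟩
    constructor
    · rintro ⟨⟨z, u'⟩, ⟨h, _⟩, h'⟩
      cases (show z = y from h')
      exact ⟨x, rfl, h⟩
    · rintro ⟨z, h', h⟩
      cases (show x = z from h')
      exact ⟨(y, u), ⟨h, rfl⟩, rfl⟩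
  pentagon W X Y Z := by
    ext ⟨⟨⟨⟨w, x⟩, y⟩, z⟩, ⟨w', x', y', z'⟩⟩
    constructor
    · rintro ⟨⟨⟨a₁, a₂, a₃⟩, a₄⟩, ⟨h₁, h₂⟩, ⟨⟨b₁, ⟨b₂, b₃⟩, b₄⟩, h₃, ⟨h₄, h₅⟩⟩⟩
      cases (show (w, x, y) = (a₁, a₂, a₃) from h₁)
      cases (show z = a₄ from h₂)
      cases (show (w, (x, y), z) = (b₁, (b₂, b₃), b₄) from h₃)
      cases (show w = w' from h₄)
      cases (show (x, y, z) = (x', y', z') from h₅)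
      exact ⟨((w, x), y, z), rfl, rfl⟩
    · rintro ⟨⟨⟨a₁, a₂⟩, a₃, a₄⟩, h₁, h₂⟩
      cases (show ((w, x), y, z) = ((a₁, a₂), a₃, a₄) from h₁)
      cases (show (w, x, y, z) = (w', x', y', z') from h₂)
      exact ⟨((w, x, y), z), ⟨rfl, rfl⟩, ⟨(w, (x, y), z), rfl, ⟨rfl, rfl⟩⟩⟩
  triangle X Y := by
    ext ⟨⟨⟨x, u⟩, y⟩, ⟨x', y'⟩⟩
    constructor
    · rintro ⟨⟨a, b, c⟩, h₁, h₂, h₃⟩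
      cases (show (x, u, y) = (a, b, c) from h₁)
      exact ⟨h₂, h₃⟩
    · rintro ⟨h₁, h₂⟩
      exact ⟨(x, u, y), rfl, h₁, h₂⟩

/-- The braiding of the category of relations is the swap `(x, y) ↦ (y, x)`. -/
instance RelCat.instSymmetricCategory : SymmetricCategory RelCat.{v} where
  braiding X Y := RelCat.isoOfEquiv (Equiv.prodComm X Y)
  braiding_naturality_right X {Y Z} r := by
    ext ⟨⟨x, y⟩, ⟨z, x'⟩⟩
    constructor
    · rintro ⟨⟨a, b⟩, ⟨h₁, h₂⟩, h₃⟩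
      cases (show x = a from h₁)
      cases (show (b, x) = (z, x') from h₃)
      exact ⟨(y, x), rfl, h₂, rfl⟩
    · rintro ⟨⟨a, b⟩, h₁, h₂, h₃⟩
      cases (show (y, x) = (a, b) from h₁)
      cases (show x = x' from h₃)
      exact ⟨(x, z), ⟨rfl, h₂⟩, rfl⟩
  braiding_naturality_left {X Y} r Z := by
    ext ⟨⟨x, z⟩, ⟨z', y⟩⟩
    constructor
    · rintro ⟨⟨a, b⟩, ⟨h₁, h₂⟩, h₃⟩
      cases (show z = b from h₂)
      cases (show (z, a) = (z', y) from h₃)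
      exact ⟨(z, x), rfl, rfl, h₁⟩
    · rintro ⟨⟨a, b⟩, h₁, h₂, h₃⟩
      cases (show (z, x) = (a, b) from h₁)
      cases (show z = z' from h₂)
      exact ⟨(y, z), ⟨h₃, rfl⟩, rfl⟩
  hexagon_forward X Y Z := by
    ext ⟨⟨⟨x, y⟩, z⟩, ⟨y', z', x'⟩⟩
    constructor
    · rintro ⟨⟨a, b, c⟩, h₁, ⟨⟨⟨d, e⟩, f⟩, h₂, h₃⟩⟩
      cases (show (x, y, z) = (a, b, c) from h₁)
      cases (show ((y, z), x) = ((d, e), f) from h₂)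
      cases (show (y, z, x) = (y', z', x') from h₃)
      exact ⟨((y, x), z), ⟨rfl, rfl⟩, ⟨(y, x, z), rfl, ⟨rfl, rfl⟩⟩⟩
    · rintro ⟨⟨⟨a, b⟩, c⟩, ⟨h₁, h₂⟩, ⟨⟨d, e, f⟩, h₃, ⟨h₄, h₅⟩⟩⟩
      cases (show (y, x) = (a, b) from h₁)
      cases (show z = c from h₂)
      cases (show (y, x, z) = (d, e, f) from h₃)
      cases (show y = y' from h₄)
      cases (show (z, x) = (z', x') from h₅)
      exact ⟨(x, y, z), rfl, ⟨((y, z), x), rfl, rfl⟩⟩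
  hexagon_reverse X Y Z := by
    ext ⟨⟨x, y, z⟩, ⟨⟨z', x'⟩, y'⟩⟩
    constructor
    · rintro ⟨⟨⟨a, b⟩, c⟩, h₁, ⟨⟨d, e, f⟩, h₂, h₃⟩⟩
      cases (show ((a, b), c) = ((x, y), z) from (Equiv.prodAssoc X Y Z).injective h₁)
      cases (show (z, x, y) = (d, e, f) from h₂)
      cases (show ((z', x'), y') = ((z, x), y) from (Equiv.prodAssoc Z X Y).injective h₃)
      exact ⟨(x, z, y), ⟨rfl, rfl⟩, ⟨((x, z), y), rfl, ⟨rfl, rfl⟩⟩⟩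
    · rintro ⟨⟨a, b, c⟩, ⟨h₁, h₂⟩, ⟨⟨⟨d, e⟩, f⟩, h₃, ⟨h₄, h₅⟩⟩⟩
      cases (show x = a from h₁)
      cases (show (z, y) = (b, c) from h₂)
      cases (show ((d, e), f) = ((x, z), y) from (Equiv.prodAssoc X Z Y).injective h₃)
      cases (show (z, x) = (z', x') from h₄)
      cases (show y = y' from h₅)
      exact ⟨((x, y), z), rfl, ⟨(z, x, y), rfl, rfl⟩⟩
  symmetry X Y := by
    ext ⟨⟨x, y⟩, ⟨x', y'⟩⟩
    constructor
    · rintro ⟨⟨a, b⟩, h₁, h₂⟩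
      cases (show (y, x) = (a, b) from h₁)
      cases (show (x, y) = (x', y') from h₂)
      rfl
    · intro h
      cases (show (x, y) = (x', y') from h)
      exact ⟨(y, x), rfl, rfl⟩

end Rel

/-- The functor `E` is a strong symmetric monoidal dagger equivalence, where the unit comparison is
`* ↦ 1`, the tensor comparison is `(x, y) ↦ x ⊗ y`, and both consist of dagger isomorphisms. -/
structure IsAtomMonoidalDaggerEquivalence {C : Type u} [Category.{v} C] [DaggerCategory C]
    [HasZeroMorphisms C] [MonoidalCategory C] [SymmetricCategory C]
    (h : HasDaggerBiproducts C) (hE : AtomFunctorial h) : Prop where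
  daggerEquivalence : IsDaggerEquivalence (atomFunctor h hE)
  monoidal : ∃ B : (atomFunctor h hE).Braided,
    B.ε = RelCat.Hom.ofRel {p : 𝟙_ RelCat.{v} × AtomObj h (𝟙_ C) | p.2.mor = 𝟙 (𝟙_ C)} ∧
    IsDaggerIso B.ε ∧
    (∀ X Y : C, B.μ X Y = RelCat.Hom.ofRel
      {p : (AtomObj h X × AtomObj h Y) × AtomObj h (X ⊗ Y) |
        p.2.mor = (λ_ (𝟙_ C)).inv ≫ (p.1.1.mor ⊗ₘ p.1.2.mor)}) ∧
    ∀ X Y : C, IsDaggerIso (B.μ X Y)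

/-! ### Infinitary addition of parallel morphisms -/

section Sums

variable {C : Type u} [Category.{v} C] [DaggerCategory C]

/-! Call the morphisms from `I` to `X` points of `X`, and say that points `u`, `v` meet when `v‡ ∘ u
= 1`. Biproducts give an infinitary addition over which composition distributes. A Hilbert hotel
argument and invertibility of nonzero scalars give `1 + 1 = 1`; comparison with the sum of all
scalars then leaves only the scalars `0` and `1` (`scalar_eq_one`). As `I` separates, a morphism is
a Boolean matrix of values on pairs of points (`ext_iff`), ordered entrywise.

For a point `x`, the kernel of `x‡` and its complement yield two projections with sum the identity.
Hence points that meet have a nonzero common lower bound (`exists_common_lower_bound`).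

The crux is atomicity (`exists_isHomAtom_homLE`). Compact closure turns endomorphisms of `X` into
points, so the identity has a complement `n`. A nonzero point that is not an atom contains two
disjoint nonzero parts, which forces `n` to send it to a point meeting every nonzero point. If no
atom lay below `x`, the projection onto the support of `x` would therefore lie below both `n` and
the identity, hence vanish.

So the atoms form an orthonormal basis (`isPointBasis_atom`), and matrices over bases compose as
relations: this gives functoriality and faithfulness. Sums of rank-one morphisms give fullness,
biproducts of copies of `I` essential surjectivity. Every basis consists of all the atoms, and
products of bases are bases because tensoring preserves sums (`IsPointBasis.tensor`), so the
monoidal comparisons are bijections. The converse is a direct check on elements. -/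

theorem dagger_injective {X Y : C} {f g : X ⟶ Y} (h : f‡ = g‡) : f = g := by
  rw [← DaggerCategory.dagger_dagger f, h, DaggerCategory.dagger_dagger]

variable [HasZeroMorphisms C]

theorem dagger_zero (X Y : C) : (0 : X ⟶ Y)‡ = 0 := by
  have h := DaggerCategory.dagger_comp (0 : X ⟶ Y) ((0 : X ⟶ Y)‡)
  rw [zero_comp, DaggerCategory.dagger_dagger, zero_comp] at h
  rw [← zero_comp (X := X) (f := (0 : X ⟶ Y)), DaggerCategory.dagger_comp, h, comp_zero]

namespace DaggerBiproduct

variable {M : Type*} {f : M → C} (B : DaggerBiproduct f)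

theorem hom_ext {W : C} {g g' : W ⟶ B.bicone.pt}
    (h : ∀ m, g ≫ B.bicone.π m = g' ≫ B.bicone.π m) : g = g' :=
  B.isBilimit.isLimit.hom_ext fun j => h j.as

theorem hom_ext' {W : C} {g g' : B.bicone.pt ⟶ W}
    (h : ∀ m, B.bicone.ι m ≫ g = B.bicone.ι m ≫ g') : g = g' :=
  B.isBilimit.isColimit.hom_ext fun j => h j.as

/-- The morphism into a dagger biproduct with given components. -/
noncomputable def lift {W : C} (r : ∀ m, W ⟶ f m) : W ⟶ B.bicone.pt :=
  B.isBilimit.isLimit.lift (Fan.mk W r)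

@[simp]
theorem lift_π {W : C} (r : ∀ m, W ⟶ f m) (m : M) : B.lift r ≫ B.bicone.π m = r m :=
  B.isBilimit.isLimit.fac _ (Discrete.mk m)

theorem ι_eq (m : M) : B.bicone.ι m = (B.bicone.π m)‡ := by
  rw [B.π_eq, DaggerCategory.dagger_dagger]

variable {Y : C} (B : DaggerBiproduct fun _ : M => Y)

theorem diag_π (m : M) : B.diag ≫ B.bicone.π m = 𝟙 Y := B.lift_π _ m

theorem ι_codiag (m : M) : B.bicone.ι m ≫ (B.diag)‡ = 𝟙 Y := by
  rw [B.ι_eq, ← DaggerCategory.dagger_comp, diag_π, DaggerCategory.dagger_id]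

end DaggerBiproduct

variable (h : HasDaggerBiproducts C)

theorem homSum_eq_lift {M : Type v} {X Y : C} (r : M → (X ⟶ Y)) :
    homSum h r = (h M fun _ => Y).some.lift r ≫ ((h M fun _ => Y).some.diag)‡ := by
  rw [homSum, ← Category.assoc]
  congr 1
  refine DaggerBiproduct.hom_ext _ fun m => ?_
  have : (h M fun _ => X).some.map (h M fun _ => Y).some r ≫ (h M fun _ => Y).some.bicone.π m =
      (h M fun _ => X).some.bicone.π m ≫ r m := DaggerBiproduct.lift_π _ _ m
  rw [DaggerBiproduct.lift_π, Category.assoc, this, ← Category.assoc, DaggerBiproduct.diag_π,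
    Category.id_comp]

theorem comp_homSum {M : Type v} {W X Y : C} (s : W ⟶ X) (r : M → (X ⟶ Y)) :
    s ≫ homSum h r = homSum h fun m => s ≫ r m := by
  rw [homSum_eq_lift, homSum_eq_lift, ← Category.assoc]
  congr 1
  exact DaggerBiproduct.hom_ext _ fun m => by simp

/-- The codiagonal is natural, as is seen on the injections. -/
theorem homSum_comp {M : Type v} {X Y Z : C} (r : M → (X ⟶ Y)) (s : Y ⟶ Z) :
    homSum h r ≫ s = homSum h fun m => r m ≫ s := by
  have key : ((h M fun _ => Y).some.diag)‡ ≫ s =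
      (h M fun _ => Y).some.map (h M fun _ => Z).some (fun _ => s) ≫
        ((h M fun _ => Z).some.diag)‡ := by
    refine DaggerBiproduct.hom_ext' _ fun m => ?_
    have : (h M fun _ => Y).some.bicone.ι m ≫
        (h M fun _ => Y).some.map (h M fun _ => Z).some (fun _ => s) =
        s ≫ (h M fun _ => Z).some.bicone.ι m := by
      refine DaggerBiproduct.hom_ext _ fun n => ?_
      have : (h M fun _ => Y).some.map (h M fun _ => Z).some (fun _ => s) ≫
          (h M fun _ => Z).some.bicone.π n =
          (h M fun _ => Y).some.bicone.π n ≫ s := DaggerBiproduct.lift_π _ _ n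
      rw [Category.assoc, this]
      by_cases hmn : m = n
      · subst hmn; simp
      · simp [hmn]
    rw [← Category.assoc, DaggerBiproduct.ι_codiag, ← Category.assoc, this, Category.assoc,
      DaggerBiproduct.ι_codiag, Category.id_comp, Category.comp_id]
  rw [homSum_eq_lift, homSum_eq_lift, Category.assoc, key, ← Category.assoc]
  congr 1
  refine DaggerBiproduct.hom_ext _ fun m => ?_
  have : (h M fun _ => Y).some.map (h M fun _ => Z).some (fun _ => s) ≫
      (h M fun _ => Z).some.bicone.π m =
      (h M fun _ => Y).some.bicone.π m ≫ s := DaggerBiproduct.lift_π _ _ m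
  rw [Category.assoc, this, DaggerBiproduct.lift_π, ← Category.assoc, DaggerBiproduct.lift_π]

theorem homSum_single {M : Type v} {X Y : C} (r : M → (X ⟶ Y)) (j : M)
    (hr : ∀ m, m ≠ j → r m = 0) : homSum h r = r j := by
  rw [homSum_eq_lift]
  have : (h M fun _ => Y).some.lift r = r j ≫ (h M fun _ => Y).some.bicone.ι j := by
    refine DaggerBiproduct.hom_ext _ fun m => ?_
    rw [DaggerBiproduct.lift_π, Category.assoc]
    by_cases hm : m = j
    · subst hm; simp
    · simp [hr m hm, Ne.symm hm]
  rw [this, Category.assoc, DaggerBiproduct.ι_codiag, Category.comp_id]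

theorem homSum_zero (M : Type v) (X Y : C) : homSum h (fun _ : M => (0 : X ⟶ Y)) = 0 := by
  have := comp_homSum h (0 : X ⟶ Y) (fun _ : M => 𝟙 Y)
  simpa using this.symm

/-- Projections distribute over sums, so a sum of lifts is the lift of the componentwise sums;
composing with the codiagonal gives the exchange. -/
theorem homSum_comm {M N : Type v} {X Y : C} (r : M → N → (X ⟶ Y)) :
    homSum h (fun m => homSum h (r m)) = homSum h fun n => homSum h fun m => r m n := by
  have key : homSum h (fun m => (h N fun _ => Y).some.lift (r m)) =
      (h N fun _ => Y).some.lift fun n => homSum h fun m => r m n :=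
    DaggerBiproduct.hom_ext _ fun n => by simp [homSum_comp]
  rw [homSum_eq_lift h fun n => homSum h fun m => r m n, ← key, homSum_comp]
  simp_rw [homSum_eq_lift h (r _)]

theorem homSum_homAdd {M : Type v} {X Y : C} (r s : M → (X ⟶ Y)) :
    homSum h (fun m => homAdd h (r m) (s m)) = homAdd h (homSum h r) (homSum h s) := by
  unfold homAdd
  rw [homSum_comm]
  congr 1
  ext ⟨b⟩
  cases b <;> simp

/-- The interchange law; inserting zeros yields commutativity and associativity, as in the
Eckmann–Hilton argument. -/
theorem homAdd_homAdd_homAdd_comm {X Y : C} (a b c d : X ⟶ Y) :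
    homAdd h (homAdd h a b) (homAdd h c d) = homAdd h (homAdd h a c) (homAdd h b d) := by
  have := homSum_homAdd h (M := ULift.{v} Bool)
    (fun i => if i.down then a else b) (fun i => if i.down then c else d)
  change _ = homAdd h (homAdd h a b) (homAdd h c d) at this
  rw [← this]
  conv_rhs => rw [homAdd]
  congr 1
  ext ⟨b⟩
  cases b <;> simp

theorem homAdd_zero {X Y : C} (r : X ⟶ Y) : homAdd h r 0 = r := by
  have := homSum_single h (fun b : ULift.{v} Bool => if b.down then r else 0) ⟨true⟩
    (by rintro ⟨b⟩ hb; cases b <;> simp_all)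
  exact this.trans (if_pos rfl)

theorem zero_homAdd {X Y : C} (r : X ⟶ Y) : homAdd h 0 r = r := by
  have := homSum_single h (fun b : ULift.{v} Bool => if b.down then 0 else r) ⟨false⟩
    (by rintro ⟨b⟩ hb; cases b <;> simp_all)
  exact this.trans (if_neg Bool.false_ne_true)

theorem homAdd_comm {X Y : C} (r s : X ⟶ Y) : homAdd h r s = homAdd h s r := by
  simpa [homAdd_zero, zero_homAdd] using homAdd_homAdd_homAdd_comm h 0 r s 0

theorem homAdd_assoc {X Y : C} (r s t : X ⟶ Y) :
    homAdd h (homAdd h r s) t = homAdd h r (homAdd h s t) := by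
  simpa [homAdd_zero, zero_homAdd] using homAdd_homAdd_homAdd_comm h r s 0 t

theorem comp_homAdd {W X Y : C} (t : W ⟶ X) (r s : X ⟶ Y) :
    t ≫ homAdd h r s = homAdd h (t ≫ r) (t ≫ s) := by
  rw [homAdd, comp_homSum, homAdd]
  congr 1
  ext ⟨b⟩
  cases b <;> simp

theorem homAdd_comp {X Y Z : C} (r s : X ⟶ Y) (t : Y ⟶ Z) :
    homAdd h r s ≫ t = homAdd h (r ≫ t) (s ≫ t) := by
  rw [homAdd, homSum_comp, homAdd]
  congr 1
  ext ⟨b⟩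
  cases b <;> simp

/-- `r j` is the sum of the family with all other terms replaced by zero, and adding that family
termwise changes nothing. -/
theorem homLE_homSum_of_homAdd_self {M : Type v} {X Y : C}
    (hid : ∀ r : X ⟶ Y, homAdd h r r = r) (r : M → (X ⟶ Y)) (j : M) :
    homLE h (r j) (homSum h r) := by
  classical
  have h₁ : homSum h (fun m => if m = j then r m else 0) = r j := by
    rw [homSum_single h _ j (by simp +contextual)]; simp
  rw [homLE, ← h₁, ← homSum_homAdd]
  congr 1
  ext m
  split_ifs
  · exact hid _
  · exact zero_homAdd h _

end Sums

/-! ### The scalars are 0 and 1; morphisms as Boolean matrices -/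

section Scalars

variable {C : Type u} [Category.{v} C] [DaggerCategory C] [HasZeroMorphisms C]
  [MonoidalCategory C] (hC : RelAxioms C)

include hC

namespace RelAxioms

theorem id_unit_ne_zero : 𝟙 (𝟙_ C) ≠ 0 := fun h =>
  hC.unit_nonzero ((IsZero.iff_id_eq_zero _).2 h)

/-- The countable sum of copies of `1` absorbs `1`. -/
theorem homSum_nat_eq_homAdd :
    homSum hC.biproducts (fun _ : ULift.{v} ℕ => 𝟙 (𝟙_ C)) =
      homAdd hC.biproducts (𝟙 (𝟙_ C)) (homSum hC.biproducts (fun _ : ULift.{v} ℕ => 𝟙 (𝟙_ C))) := by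
  classical
  set h := hC.biproducts
  -- Hilbert's hotel: each `n` is either `0` or a unique successor, so exchanging sums splits off
  -- one term and leaves a full copy.
  have h₁ : ∀ n : ULift.{v} ℕ, 𝟙 (𝟙_ C) = homAdd h (if n.down = 0 then 𝟙 (𝟙_ C) else 0)
      (homSum h fun k : ULift.{v} ℕ => if n.down = k.down + 1 then 𝟙 (𝟙_ C) else 0) := by
    rintro ⟨_ | n⟩
    · simp [homSum_zero, homAdd_zero]
    · rw [homSum_single h _ ⟨n⟩]
      · simp [zero_homAdd]
      · rintro ⟨k⟩ hk
        simp only [ne_eq, ULift.up.injEq] at hk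
        rw [if_neg (by simp only; omega)]
  conv_lhs => rw [funext h₁]
  rw [homSum_homAdd, homSum_comm]
  congr 1
  · rw [homSum_single h _ ⟨0⟩]
    · simp
    · rintro ⟨k⟩ hk
      simp only [ne_eq, ULift.up.injEq] at hk
      simp [hk]
  · congr 1
    ext k
    rw [homSum_single h _ ⟨k.down + 1⟩]
    · simp
    · rintro ⟨n⟩ hn
      simp only [ne_eq, ULift.up.injEq] at hn
      simp [hn]

/-- The countable sum of copies of `1` is idempotent. -/
theorem homAdd_homSum_nat_self :
    homAdd hC.biproducts (homSum hC.biproducts (fun _ : ULift.{v} ℕ => 𝟙 (𝟙_ C)))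
      (homSum hC.biproducts (fun _ : ULift.{v} ℕ => 𝟙 (𝟙_ C))) =
    homSum hC.biproducts (fun _ : ULift.{v} ℕ => 𝟙 (𝟙_ C)) := by
  classical
  set h := hC.biproducts
  -- Each `n` corresponds to one pair in `Bool × ℕ`, so exchanging sums splits the total into two
  -- full copies of itself.
  have h₁ : ∀ n : ULift.{v} ℕ, 𝟙 (𝟙_ C) = homSum h fun b : ULift.{v} Bool =>
      homSum h fun k : ULift.{v} ℕ =>
        if Equiv.boolProdNatEquivNat.symm n.down = (b.down, k.down) then 𝟙 (𝟙_ C) else 0 := by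
    rintro ⟨n⟩
    obtain ⟨⟨b, k⟩, rfl⟩ := Equiv.boolProdNatEquivNat.surjective n
    simp only [Equiv.symm_apply_apply, Prod.mk.injEq]
    rw [homSum_single h _ ⟨b⟩, homSum_single h _ ⟨k⟩]
    · simp
    · rintro ⟨k'⟩ hk
      simp only [ne_eq, ULift.up.injEq] at hk
      simp [Ne.symm hk]
    · rintro ⟨b'⟩ hb
      simp only [ne_eq, ULift.up.injEq] at hb
      simp [Ne.symm hb, homSum_zero]
  conv_rhs => rw [funext h₁]
  rw [homSum_comm, homAdd]
  congr 1
  ext b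
  rw [homSum_comm, ite_self]
  congr 1
  ext k
  rw [homSum_single h _ ⟨Equiv.boolProdNatEquivNat (b.down, k.down)⟩]
  · simp
  · rintro ⟨n⟩ hn
    simp only [ne_eq, ULift.up.injEq] at hn
    rw [if_neg]
    rintro h'
    exact hn (by rw [← h', Equiv.apply_symm_apply])

/-- If `t` is the countable sum of ones, `1 + t = t` forces `t ≠ 0`, so `t + t = t` can be divided
by `t`. -/
theorem homAdd_one_one : homAdd hC.biproducts (𝟙 (𝟙_ C)) (𝟙 (𝟙_ C)) = 𝟙 (𝟙_ C) := by
  have h₁ := hC.homSum_nat_eq_homAdd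
  have h₂ := hC.homAdd_homSum_nat_self
  generalize homSum hC.biproducts (fun _ : ULift.{v} ℕ => 𝟙 (𝟙_ C)) = t at h₁ h₂
  have ht : t ≠ 0 := by
    rintro rfl
    rw [homAdd_zero] at h₁
    exact hC.id_unit_ne_zero h₁.symm
  have := hC.scalar_invertible t ht
  have h₃ := congrArg (· ≫ inv t) h₂
  simpa [homAdd_comp] using h₃

theorem hom_ext {X Y : C} {f g : X ⟶ Y} (h : ∀ x : 𝟙_ C ⟶ X, x ≫ f = x ≫ g) : f = g :=
  hC.separator.def f g h

theorem hom_ext' {X Y : C} {f g : X ⟶ Y} (h : ∀ y : 𝟙_ C ⟶ Y, f ≫ y‡ = g ≫ y‡) : f = g :=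
  dagger_injective <| hC.hom_ext fun y => dagger_injective <| by
    simpa [DaggerCategory.dagger_comp, DaggerCategory.dagger_dagger] using h y

theorem homAdd_self {X Y : C} (r : X ⟶ Y) : homAdd hC.biproducts r r = r := by
  refine hC.hom_ext fun x => ?_
  have := congrArg (· ≫ x ≫ r) hC.homAdd_one_one
  simpa [homAdd_comp, comp_homAdd] using this

/-- By local smallness all scalars can be summed, to a greatest scalar `u`. Both `u ∘ u ≤ u` and,
from `1 ≤ u`, `u ≤ u ∘ u` hold, so `u` is an invertible idempotent and equals `1`. -/
theorem scalar_le_one (s : 𝟙_ C ⟶ 𝟙_ C) : homLE hC.biproducts s (𝟙 _) := by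
  set h := hC.biproducts
  let u : 𝟙_ C ⟶ 𝟙_ C := homSum h fun s : 𝟙_ C ⟶ 𝟙_ C => s
  have hu : ∀ s, homLE h s u := homLE_homSum_of_homAdd_self h hC.homAdd_self _
  have hu0 : u ≠ 0 := by
    intro h0
    have := hu (𝟙 _)
    rw [homLE, h0, homAdd_zero] at this
    exact hC.id_unit_ne_zero this
  have := hC.scalar_invertible u hu0
  have h₁ : homAdd h (u ≫ u) u = u := hu _
  have h₂ : homAdd h u (u ≫ u) = u ≫ u := by
    simpa [homAdd_comp] using congrArg (· ≫ u) (hu (𝟙 _))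
  have h₃ : u ≫ u = u := by rw [← h₂, homAdd_comm, h₁]
  have h₄ : u = 𝟙 _ := by simpa using congrArg (· ≫ inv u) h₃
  rw [← h₄]
  exact hu s

/-- Both `s` and its inverse are at most `1`; multiplying the second inequality by `s` gives `1 ≤
s`. -/
theorem scalar_eq_one {s : 𝟙_ C ⟶ 𝟙_ C} (hs : s ≠ 0) : s = 𝟙 _ := by
  have := hC.scalar_invertible s hs
  have h₁ : homAdd hC.biproducts s (𝟙 _) = 𝟙 _ := hC.scalar_le_one s
  have h₂ : homAdd hC.biproducts (inv s) (𝟙 _) = 𝟙 _ := hC.scalar_le_one (inv s)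
  have h₃ := congrArg (· ≫ s) h₂
  simp only [homAdd_comp, IsIso.inv_hom_id, Category.id_comp] at h₃
  rw [← h₃, homAdd_comm, h₁]

theorem scalar_ne_zero_iff {s : 𝟙_ C ⟶ 𝟙_ C} : s ≠ 0 ↔ s = 𝟙 _ :=
  ⟨hC.scalar_eq_one, fun h => h ▸ hC.id_unit_ne_zero⟩

theorem scalar_ext {s t : 𝟙_ C ⟶ 𝟙_ C} (h : s = 𝟙 _ ↔ t = 𝟙 _) : s = t := by
  by_cases hs : s = 𝟙 _
  · rw [hs, h.1 hs]
  · have ht := mt h.2 hs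
    rw [← hC.scalar_ne_zero_iff, not_not] at hs ht
    rw [hs, ht]

theorem scalar_dagger (s : 𝟙_ C ⟶ 𝟙_ C) : s‡ = s := by
  by_cases hs : s = 0
  · rw [hs, dagger_zero]
  · rw [hC.scalar_eq_one hs, DaggerCategory.dagger_id]

theorem scalar_homSum_eq_one_iff {M : Type v} (s : M → (𝟙_ C ⟶ 𝟙_ C)) :
    homSum hC.biproducts s = 𝟙 _ ↔ ∃ m, s m = 𝟙 _ := by
  constructor
  · intro h
    by_contra! h'
    simp_rw [ne_eq, ← hC.scalar_ne_zero_iff, not_not] at h'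
    rw [funext h', homSum_zero] at h
    exact hC.id_unit_ne_zero h.symm
  · rintro ⟨m, hm⟩
    rw [← hC.scalar_ne_zero_iff]
    intro h0
    have := homLE_homSum_of_homAdd_self _ hC.homAdd_self s m
    rw [homLE, h0, homAdd_zero, hm] at this
    exact hC.id_unit_ne_zero this

theorem scalar_comp_eq_one_iff {s t : 𝟙_ C ⟶ 𝟙_ C} : s ≫ t = 𝟙 _ ↔ s = 𝟙 _ ∧ t = 𝟙 _ := by
  constructor
  · intro h
    constructor <;> rw [← hC.scalar_ne_zero_iff] <;> rintro rfl <;>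
      simp only [zero_comp, comp_zero] at h <;> exact hC.id_unit_ne_zero h.symm
  · rintro ⟨rfl, rfl⟩
    simp

/-- Points separate on the domain side and, by the dagger, on the codomain side; the resulting
scalars are `0` or `1`. -/
theorem ext_iff {X Y : C} {r s : X ⟶ Y} :
    r = s ↔ ∀ x y, x ≫ r ≫ y‡ = 𝟙 (𝟙_ C) ↔ x ≫ s ≫ y‡ = 𝟙 (𝟙_ C) :=
  ⟨fun h => by simp [h], fun h => hC.hom_ext' fun y => hC.hom_ext fun x => hC.scalar_ext (h x y)⟩

theorem homSum_eq_one_iff {M : Type v} {X Y : C} (r : M → (X ⟶ Y)) (x y) :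
    x ≫ homSum hC.biproducts r ≫ y‡ = 𝟙 (𝟙_ C) ↔ ∃ m, x ≫ r m ≫ y‡ = 𝟙 (𝟙_ C) := by
  rw [homSum_comp, comp_homSum, hC.scalar_homSum_eq_one_iff]

theorem homAdd_eq_one_iff {X Y : C} (r s : X ⟶ Y) (x y) :
    x ≫ homAdd hC.biproducts r s ≫ y‡ = 𝟙 (𝟙_ C) ↔
      x ≫ r ≫ y‡ = 𝟙 (𝟙_ C) ∨ x ≫ s ≫ y‡ = 𝟙 (𝟙_ C) := by
  rw [homAdd, hC.homSum_eq_one_iff, ULift.exists, Bool.exists_bool, or_comm]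
  simp

theorem homLE_iff {X Y : C} {r s : X ⟶ Y} : homLE hC.biproducts r s ↔
    ∀ x y, x ≫ r ≫ y‡ = 𝟙 (𝟙_ C) → x ≫ s ≫ y‡ = 𝟙 (𝟙_ C) := by
  rw [homLE, hC.ext_iff]
  simp only [hC.homAdd_eq_one_iff]
  grind

/-- Two elements `u, v` of `C(I, X)` meet if `v‡ ∘ u = 1`; the order is that of the sets of elements
met. -/
theorem point_homLE_iff {X : C} {u v : 𝟙_ C ⟶ X} : homLE hC.biproducts u v ↔
    ∀ w, u ≫ w‡ = 𝟙 (𝟙_ C) → v ≫ w‡ = 𝟙 (𝟙_ C) := by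
  rw [hC.homLE_iff]
  refine ⟨fun h w hw => by simpa using h (𝟙 _) w (by simpa using hw), fun h x w hw => ?_⟩
  rw [hC.scalar_comp_eq_one_iff] at hw ⊢
  exact ⟨hw.1, h _ hw.2⟩

theorem point_homSum_eq_one_iff {M : Type v} {X : C} (r : M → (𝟙_ C ⟶ X)) (y) :
    homSum hC.biproducts r ≫ y‡ = 𝟙 (𝟙_ C) ↔ ∃ m, r m ≫ y‡ = 𝟙 (𝟙_ C) := by
  rw [homSum_comp, hC.scalar_homSum_eq_one_iff]

theorem comp_dagger_symm {X : C} (u v : 𝟙_ C ⟶ X) : u ≫ v‡ = v ≫ u‡ := by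
  rw [← hC.scalar_dagger (u ≫ v‡), DaggerCategory.dagger_comp, DaggerCategory.dagger_dagger]

theorem comp_dagger_ne_one_iff {X : C} {u v : 𝟙_ C ⟶ X} :
    u ≫ v‡ ≠ 𝟙 (𝟙_ C) ↔ u ≫ v‡ = 0 := by
  rw [ne_eq, ← hC.scalar_ne_zero_iff, not_not]

theorem homLE_antisymm {X Y : C} {r s : X ⟶ Y} (h₁ : homLE hC.biproducts r s)
    (h₂ : homLE hC.biproducts s r) : r = s := by
  rw [← h₂, homAdd_comm, h₁]

end RelAxioms

end Scalars

/-! ### Tensoring preserves zero and sums -/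

section Tensor

variable {C : Type u} [Category.{v} C] [DaggerCategory C]
  [MonoidalCategory C] [SymmetricCategory C] [IsDaggerCompactClosed C]

theorem exists_exactPairing (X : C) : ∃ D : C, Nonempty (ExactPairing D X) := by
  obtain ⟨D, p, -⟩ := IsDaggerCompactClosed.exists_dual X
  exact ⟨D, ⟨p⟩⟩

variable [HasZeroMorphisms C]

/-- By naturality of transposition, composing `X ◁ 0` with a map gives the transpose of zero,
whatever the map; the identity and the zero map are compared. -/
theorem whiskerLeft_zero_of_compactClosed (X Y Z : C) : X ◁ (0 : Y ⟶ Z) = 0 := by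
  obtain ⟨D, ⟨p⟩⟩ := exists_exactPairing X
  have h (W : C) (g : Z ⟶ D ⊗ W) :=
    tensorLeftHomEquiv_symm_naturality (Y := D) (Y' := X) (0 : Y ⟶ Z) g
  have h₁ := h _ (tensorLeftHomEquiv Z D X _ (𝟙 (X ⊗ Z)))
  have h₂ := h _ (tensorLeftHomEquiv Z D X _ (0 : X ⊗ Z ⟶ X ⊗ Z))
  rw [Equiv.symm_apply_apply, zero_comp] at h₁ h₂
  rw [← Category.comp_id (X ◁ (0 : Y ⟶ Z)), ← h₁, h₂, comp_zero]

/-- Tensoring with `X` is a left adjoint, so it keeps the injections jointly epic. -/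
theorem DaggerBiproduct.whiskerLeft_hom_ext {M : Type*} {f : M → C} (B : DaggerBiproduct f)
    (X : C) {Z : C} {g g' : X ⊗ B.bicone.pt ⟶ Z}
    (h : ∀ m, X ◁ B.bicone.ι m ≫ g = X ◁ B.bicone.ι m ≫ g') : g = g' := by
  obtain ⟨D, ⟨p⟩⟩ := exists_exactPairing X
  apply (tensorLeftHomEquiv _ D X _).injective
  refine B.hom_ext' fun m => (tensorLeftHomEquiv _ D X _).symm.injective ?_
  rw [tensorLeftHomEquiv_symm_naturality, tensorLeftHomEquiv_symm_naturality,
    Equiv.symm_apply_apply, Equiv.symm_apply_apply, h]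

theorem whiskerLeft_homSum (h : HasDaggerBiproducts C) {M : Type v} (X : C) {Y Z : C}
    (r : M → (Y ⟶ Z)) : X ◁ homSum h r = homSum h fun m => X ◁ r m := by
  classical
  set B := (h M fun _ => Z).some with hB
  have key : X ◁ (B.diag)‡ = homSum h fun m => X ◁ B.bicone.π m := by
    refine B.whiskerLeft_hom_ext X fun j => ?_
    rw [← whiskerLeft_comp, B.ι_codiag, comp_homSum, homSum_single h _ j]
    · simp [← whiskerLeft_comp]
    · intro m hm
      simp [← whiskerLeft_comp, Ne.symm hm, whiskerLeft_zero_of_compactClosed]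
  rw [homSum_eq_lift, ← hB, whiskerLeft_comp, key, comp_homSum]
  simp [← whiskerLeft_comp]

theorem homSum_whiskerRight (h : HasDaggerBiproducts C) {M : Type v} {Y Z : C}
    (r : M → (Y ⟶ Z)) (X : C) : homSum h r ▷ X = homSum h fun m => r m ▷ X := by
  have (f : Y ⟶ Z) : f ▷ X = (β_ Y X).hom ≫ X ◁ f ≫ (β_ Z X).inv := by simp
  simp_rw [this]
  rw [whiskerLeft_homSum, homSum_comp, comp_homSum]

theorem whiskerLeft_homAdd (h : HasDaggerBiproducts C) (X : C) {Y Z : C}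
    (r s : Y ⟶ Z) : X ◁ homAdd h r s = homAdd h (X ◁ r) (X ◁ s) := by
  rw [homAdd, whiskerLeft_homSum, homAdd]
  congr 1
  ext ⟨b⟩
  cases b <;> simp

/-- Endomorphisms correspond additively to the elements of `C(I, X^* ⊗ X)`. -/
theorem exists_additive_name (h : HasDaggerBiproducts C) (X : C) :
    ∃ (P : C) (e : (X ⟶ X) ≃ (𝟙_ C ⟶ P)),
      ∀ r s, e (homAdd h r s) = homAdd h (e r) (e s) := by
  obtain ⟨D, ⟨p⟩⟩ := exists_exactPairing X
  refine ⟨D ⊗ X, ((ρ_ X).symm.homFromEquiv).trans (tensorLeftHomEquiv (𝟙_ C) D X X),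
    fun r s => ?_⟩
  simp [tensorLeftHomEquiv, whiskerLeft_homAdd, comp_homAdd]

end Tensor

/-! ### Factorisation through kernels -/

section Kernels

variable {C : Type u} [Category.{v} C] [HasZeroMorphisms C]

theorem IsKernelOf.exists_fac {A X Y W : C} {k : A ⟶ X} {f : X ⟶ Y} (hk : IsKernelOf k f)
    (g : W ⟶ X) (hg : g ≫ f = 0) : ∃ l, g = l ≫ k := by
  obtain ⟨w, ⟨hl⟩⟩ := hk
  obtain ⟨l, hl⟩ := KernelFork.IsLimit.lift' hl g hg
  exact ⟨l, hl.symm⟩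

theorem IsKernelOf.condition {A X Y : C} {k : A ⟶ X} {f : X ⟶ Y} (hk : IsKernelOf k f) :
    k ≫ f = 0 := hk.1

end Kernels

/-! ### Supports, complements and atomicity -/

section Boolean

variable {C : Type u} [Category.{v} C] [DaggerCategory C] [HasZeroMorphisms C]
  [MonoidalCategory C] (hC : RelAxioms C)

namespace RelAxioms

include hC

/-- `z` factors through the kernel `k` of `z‡`, yet `k‡ ∘ z` is the adjoint of `z‡ ∘ k = 0`. -/
theorem eq_zero_of_comp_dagger_self {X : C} {z : 𝟙_ C ⟶ X} (hz : z ≫ z‡ = 0) : z = 0 := by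
  obtain ⟨A, k, hk, hm⟩ := hC.kernels (z‡)
  obtain ⟨l, hl⟩ := hk.exists_fac z hz
  have h₁ : z ≫ k‡ = 0 := dagger_injective <| by
    rw [DaggerCategory.dagger_comp, DaggerCategory.dagger_dagger, hk.condition, dagger_zero]
  rw [hl, Category.assoc, hm, Category.comp_id] at h₁
  rw [hl, h₁, zero_comp]

theorem comp_dagger_self_eq_one {X : C} {z : 𝟙_ C ⟶ X} (hz : z ≠ 0) : z ≫ z‡ = 𝟙 (𝟙_ C) :=
  hC.scalar_eq_one fun h => hz (hC.eq_zero_of_comp_dagger_self h)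

/-- The projection onto the support of an element `x`. -/
theorem exists_support {X : C} (x : 𝟙_ C ⟶ X) :
    ∃ q : X ⟶ X, (∀ u : 𝟙_ C ⟶ X, homLE hC.biproducts (u ≫ q) u) ∧
      (∀ u, homLE hC.biproducts (u ≫ q) x) ∧ ∀ u : 𝟙_ C ⟶ X, u ≫ q = 0 → x ≫ u‡ = 0 := by
  obtain ⟨A, k, hk, hm⟩ := hC.kernels (x‡)
  obtain ⟨A', k', hk', hm'⟩ := hC.kernels (k‡)
  have h₀ : k' ≫ k‡ = 0 := hk'.condition
  have h₁ : k ≫ k'‡ = 0 := dagger_injective <| by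
    rw [DaggerCategory.dagger_comp, DaggerCategory.dagger_dagger, h₀, dagger_zero]
  have h₂ : x ≫ k‡ = 0 := dagger_injective <| by
    rw [DaggerCategory.dagger_comp, DaggerCategory.dagger_dagger, hk.condition, dagger_zero]
  -- Joint epicness makes the projections onto a kernel and its complement add up to the identity.
  have hid : homAdd hC.biproducts (k‡ ≫ k) (k'‡ ≫ k') = 𝟙 X := by
    refine hC.jointlyEpic k k' ⟨hm, _, _, hk⟩ ⟨hm', hk'⟩ _ _ ?_ ?_
    · rw [comp_homAdd, ← Category.assoc, hm, ← Category.assoc, h₁, zero_comp, homAdd_zero,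
        Category.id_comp, Category.comp_id]
    · rw [comp_homAdd, ← Category.assoc, h₀, ← Category.assoc, hm', zero_comp, zero_homAdd,
        Category.id_comp, Category.comp_id]
  have hx : x ≫ k'‡ ≫ k' = x := by
    have := congrArg (x ≫ ·) hid
    simp only [comp_homAdd, Category.comp_id] at this
    rwa [← Category.assoc, h₂, zero_comp, zero_homAdd] at this
  have hxu (u : 𝟙_ C ⟶ X) : x ≫ u‡ = x ≫ (u ≫ k'‡ ≫ k')‡ := by
    conv_lhs => rw [← hx]
    simp [DaggerCategory.dagger_comp, DaggerCategory.dagger_dagger]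
  refine ⟨k'‡ ≫ k', fun u => ?_, fun u => ?_, fun u hu => ?_⟩
  · conv_rhs => rw [← Category.comp_id u, ← hid, comp_homAdd]
    rw [homLE, homAdd_comm, homAdd_assoc, hC.homAdd_self]
  · rw [hC.point_homLE_iff]
    intro w hw
    -- If `x` misses `w`, the projection of `w` lies both in the kernel of `x‡` and in its
    -- complement, hence is zero. The projection being self-adjoint, the projection of `u` then
    -- misses `w`.
    by_contra hxw
    rw [← ne_eq, hC.comp_dagger_ne_one_iff, hxu] at hxw
    obtain ⟨l, hl⟩ := hk.exists_fac (w ≫ k'‡ ≫ k') (by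
      rw [← hC.scalar_dagger ((w ≫ k'‡ ≫ k') ≫ x‡), DaggerCategory.dagger_comp,
        DaggerCategory.dagger_dagger, hxw])
    have hl' := congrArg (· ≫ k‡) hl
    simp only [Category.assoc, h₀, comp_zero] at hl'
    rw [IsDaggerMono] at hm
    rw [hm, Category.comp_id] at hl'
    rw [← hl', zero_comp] at hl
    have h₃ : (u ≫ k'‡ ≫ k') ≫ w‡ = u ≫ (w ≫ k'‡ ≫ k')‡ := by
      simp [DaggerCategory.dagger_comp, DaggerCategory.dagger_dagger]
    rw [h₃, hl, dagger_zero, comp_zero] at hw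
    exact hC.id_unit_ne_zero hw.symm
  · rw [hxu, hu, dagger_zero, comp_zero]

/-- Projecting `u` onto the support of `w` gives something nonzero because the two meet. -/
theorem exists_common_lower_bound {X : C} {w u : 𝟙_ C ⟶ X} (h : w ≫ u‡ = 𝟙 (𝟙_ C)) :
    ∃ z, z ≠ 0 ∧ homLE hC.biproducts z w ∧ homLE hC.biproducts z u := by
  obtain ⟨q, hq₁, hq₂, hq₃⟩ := hC.exists_support w
  refine ⟨u ≫ q, fun h0 => ?_, hq₂ u, hq₁ u⟩
  rw [hq₃ u h0] at h
  exact hC.id_unit_ne_zero h.symm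

theorem eq_zero_of_homLE {X : C} {z x y : 𝟙_ C ⟶ X} (hx : homLE hC.biproducts z x)
    (hy : homLE hC.biproducts z y) (hxy : x ≫ y‡ = 0) : z = 0 := by
  by_contra hz
  have h₁ := hC.point_homLE_iff.1 hx _ (hC.comp_dagger_self_eq_one hz)
  rw [hC.comp_dagger_symm] at h₁
  have h₂ := hC.point_homLE_iff.1 hy _ h₁
  rw [hC.comp_dagger_symm, hxy] at h₂
  exact hC.id_unit_ne_zero h₂.symm

/-- Every element of `C(I, X)` has a complement. -/
theorem exists_compl {X : C} (x : 𝟙_ C ⟶ X) :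
    ∃ n, x ≫ n‡ = 0 ∧ ∀ y, homLE hC.biproducts y (homAdd hC.biproducts x n) := by
  classical
  let n : 𝟙_ C ⟶ X := homSum hC.biproducts fun y : {y : 𝟙_ C ⟶ X // x ≫ y‡ = 0} => y.1
  have hn : x ≫ n‡ = 0 := by
    rw [← hC.comp_dagger_ne_one_iff, hC.comp_dagger_symm, ne_eq, hC.point_homSum_eq_one_iff]
    rintro ⟨⟨y, hy⟩, h⟩
    rw [hC.comp_dagger_symm, hy] at h
    exact hC.id_unit_ne_zero h.symm
  refine ⟨n, hn, fun y => hC.point_homLE_iff.2 fun w hw => ?_⟩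
  rw [homAdd_comp, ← hC.scalar_ne_zero_iff]
  intro h0
  have hw0 : w ≠ 0 := by
    rintro rfl
    rw [dagger_zero, comp_zero] at hw
    exact hC.id_unit_ne_zero hw.symm
  have h₁ : x ≫ w‡ = 0 := by
    rw [← hC.comp_dagger_ne_one_iff]
    intro h1
    have := hC.scalar_le_one (n ≫ w‡)
    rw [homLE, homAdd_comm, ← h1, h0, h1] at this
    exact hC.id_unit_ne_zero this.symm
  -- A nonzero `w` missing `x` is itself a summand of `n`, and it meets itself.
  have h₂ : n ≫ w‡ = 𝟙 _ :=
    (hC.point_homSum_eq_one_iff _ _).2 ⟨⟨w, h₁⟩, hC.comp_dagger_self_eq_one hw0⟩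
  rw [h₁, h₂, zero_homAdd] at h0
  exact hC.id_unit_ne_zero h0

/-- A nonzero element that is not an atom is sent to the top by the complement of the identity. -/
theorem comp_eq_one_of_not_isHomAtom {X : C} {n : X ⟶ X}
    (hn : ∀ r, homLE hC.biproducts r (homAdd hC.biproducts (𝟙 X) n)) {z : 𝟙_ C ⟶ X} (hz : z ≠ 0)
    (hza : ¬ IsHomAtom hC.biproducts z) {w : 𝟙_ C ⟶ X} (hw : w ≠ 0) :
    (z ≫ n) ≫ w‡ = 𝟙 (𝟙_ C) := by
  -- The rank-one morphism `b‡ ≫ y` lies below `1 + n` and has entry `1` at `(b, y)`; where the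
  -- identity does not have that entry, `n` must.
  have cover {b : 𝟙_ C ⟶ X} (hb : b ≠ 0) {y : 𝟙_ C ⟶ X} (hy : y ≠ 0) (hby : b ≫ y‡ ≠ 𝟙 (𝟙_ C)) :
      (b ≫ n) ≫ y‡ = 𝟙 (𝟙_ C) := by
    have h := hC.homLE_iff.1 (hn (b‡ ≫ y)) b y (by
      simp [hC.comp_dagger_self_eq_one hy, hC.comp_dagger_self_eq_one hb])
    rw [hC.homAdd_eq_one_iff, Category.id_comp] at h
    simpa [hby] using h
  have mono {b y y' : 𝟙_ C ⟶ X} (hb : homLE hC.biproducts b z) (hy : homLE hC.biproducts y' y)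
      (h : (b ≫ n) ≫ y'‡ = 𝟙 (𝟙_ C)) : (z ≫ n) ≫ y‡ = 𝟙 (𝟙_ C) := by
    rw [hC.comp_dagger_symm] at h
    have h₁ := hC.point_homLE_iff.1 hy _ h
    rw [hC.comp_dagger_symm] at h₁
    refine hC.point_homLE_iff.1 ?_ _ h₁
    rw [homLE, ← homAdd_comp, hb]
  -- The aim is two nonzero parts `b`, `c` of `z` that do not meet. If `b` misses `w`, `cover`
  -- applies to `b` and `w`; otherwise it applies to `c` and a common part of `b` and `w`, which `c`
  -- misses.
  obtain ⟨b, hbz, hb, hbne⟩ : ∃ b, homLE hC.biproducts b z ∧ b ≠ 0 ∧ b ≠ z := by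
    simpa [IsHomAtom, hz] using hza
  obtain ⟨u, hzu, hbu⟩ : ∃ u, z ≫ u‡ = 𝟙 (𝟙_ C) ∧ b ≫ u‡ ≠ 𝟙 (𝟙_ C) := by
    by_contra! h
    exact hbne (hC.homLE_antisymm hbz (hC.point_homLE_iff.2 h))
  obtain ⟨c, hc, hcz, hcu⟩ := hC.exists_common_lower_bound hzu
  have hcb : c ≫ b‡ ≠ 𝟙 (𝟙_ C) := fun h => hbu <| by
    rw [hC.comp_dagger_symm]
    exact hC.point_homLE_iff.1 hcu _ h
  by_cases hbw : b ≫ w‡ = 𝟙 (𝟙_ C)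
  · obtain ⟨y, hy, hyb, hyw⟩ := hC.exists_common_lower_bound hbw
    refine mono hcz hyw (cover hc hy fun h => hcb ?_)
    rw [hC.comp_dagger_symm] at h ⊢
    exact hC.point_homLE_iff.1 hyb _ h
  · exact mono hbz ((hC.homAdd_self w) : homLE hC.biproducts w w) (cover hb hw hbw)

variable [SymmetricCategory C] [IsDaggerCompactClosed C]

/-- The identity has a complement in the hom set `C(X, X)`. -/
theorem exists_compl_id (X : C) : ∃ n : X ⟶ X,
    (∀ r, homLE hC.biproducts r (homAdd hC.biproducts (𝟙 X) n)) ∧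
      ∀ q, homLE hC.biproducts q (𝟙 X) → homLE hC.biproducts q n → q = 0 := by
  obtain ⟨P, e, he⟩ := exists_additive_name hC.biproducts X
  have hle (r s : X ⟶ X) : homLE hC.biproducts (e r) (e s) ↔ homLE hC.biproducts r s := by
    rw [homLE, ← he, e.apply_eq_iff_eq, homLE]
  obtain ⟨m, hm, hm'⟩ := hC.exists_compl (e (𝟙 X))
  obtain ⟨n, rfl⟩ := e.surjective m
  refine ⟨n, fun r => ?_, fun q h₁ h₂ => ?_⟩
  · rw [← hle, he]
    exact hm' _
  · have hq := hC.eq_zero_of_homLE ((hle _ _).2 h₁) ((hle _ _).2 h₂) hm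
    -- An additive bijection preserves zero: apply additivity to `0 + z`, where `e z = 0`.
    obtain ⟨z, hz⟩ := e.surjective 0
    have h0 := he 0 z
    rw [zero_homAdd, hz, homAdd_zero] at h0
    exact e.injective (hq.trans h0)

/-- If no atom lies below `x`, every nonzero value of the support projection `q` is a non-atom,
which the complement `n` of the identity sends to a point meeting all nonzero points. Hence `q` lies
below `n` as well as below the identity, so `q = 0` and `x = 0`. -/
theorem exists_isHomAtom_homLE {X : C} {x : 𝟙_ C ⟶ X} (hx : x ≠ 0) :
    ∃ a, IsHomAtom hC.biproducts a ∧ homLE hC.biproducts a x := by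
  by_contra! hno
  obtain ⟨n, hn, hn'⟩ := hC.exists_compl_id X
  obtain ⟨q, hq₁, hq₂, hq₃⟩ := hC.exists_support x
  have hq : q = 0 := by
    refine hn' q ?_ ?_ <;> rw [hC.homLE_iff] <;> intro y w hw
    · have := hC.point_homLE_iff.1 (hq₁ y) w (by simpa using hw)
      simpa using this
    · have hyq : y ≫ q ≠ 0 := by
        intro h
        rw [← Category.assoc, h, zero_comp] at hw
        exact hC.id_unit_ne_zero hw.symm
      have hw0 : w ≠ 0 := by
        rintro rfl
        rw [dagger_zero, comp_zero, comp_zero] at hw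
        exact hC.id_unit_ne_zero hw.symm
      have h₁ := hC.comp_eq_one_of_not_isHomAtom hn hyq (fun h => hno _ h (hq₂ y)) hw0
      have h₂ : homLE hC.biproducts ((y ≫ q) ≫ n) (y ≫ n) := by
        rw [homLE, ← homAdd_comp, hq₁ y]
      simpa using hC.point_homLE_iff.1 h₂ _ h₁
  have h₁ := hq₃ x (by rw [hq, comp_zero])
  exact hx (hC.eq_zero_of_comp_dagger_self h₁)

end RelAxioms

end Boolean

theorem IsDaggerIso.dagger_inv {C : Type u} [Category.{v} C] [DaggerCategory C] {X Y : C}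
    {e : X ≅ Y} (he : IsDaggerIso e.hom) : (e.inv)‡ = e.hom := by
  have : e.inv = (e.hom)‡ := by
    rw [← Category.comp_id e.inv, Iso.inv_comp_eq, he.1]
  rw [this, DaggerCategory.dagger_dagger]

/-! ### Bases of points and the dagger equivalence -/

section Basis

variable {C : Type u} [Category.{v} C] [DaggerCategory C] [HasZeroMorphisms C]
  [MonoidalCategory C]

/-- A family of elements of `C(I, X)` is a basis if it is orthonormal and complete. -/
structure IsPointBasis {M : Type v} {X : C} (e : M → (𝟙_ C ⟶ X)) : Prop where
  orthonormal : ∀ i j, e i ≫ (e j)‡ = 𝟙 (𝟙_ C) ↔ i = j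
  complete : ∀ x w : 𝟙_ C ⟶ X, x ≫ w‡ = 𝟙 (𝟙_ C) ↔
    ∃ m, x ≫ (e m)‡ = 𝟙 (𝟙_ C) ∧ e m ≫ w‡ = 𝟙 (𝟙_ C)

variable (hC : RelAxioms C)

namespace IsPointBasis

variable {M : Type v} {X : C} {e : M → (𝟙_ C ⟶ X)} (he : IsPointBasis e)

include hC he

theorem ne_zero (m : M) : e m ≠ 0 := by
  intro h
  have := (he.orthonormal m m).2 rfl
  rw [h, zero_comp] at this
  exact hC.id_unit_ne_zero this.symm

theorem homLE_of_comp_dagger {m : M} {x : 𝟙_ C ⟶ X} (h : x ≫ (e m)‡ = 𝟙 (𝟙_ C)) :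
    homLE hC.biproducts (e m) x :=
  hC.point_homLE_iff.2 fun _ hw => (he.complete _ _).2 ⟨m, h, hw⟩

/-- A nonzero `b` below `e m` meets itself, hence some `e k`; then `e m` meets `e k`, so `k = m` and
`e m ≤ b`. -/
theorem isHomAtom (m : M) : IsHomAtom hC.biproducts (e m) := by
  refine ⟨he.ne_zero hC m, fun b hb => or_iff_not_imp_left.2 fun hb0 => ?_⟩
  obtain ⟨k, hk, -⟩ := (he.complete _ _).1 (hC.comp_dagger_self_eq_one hb0)
  have hkm := (he.orthonormal m k).1 (hC.point_homLE_iff.1 hb _ hk)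
  subst hkm
  exact hC.homLE_antisymm hb (he.homLE_of_comp_dagger hC hk)

theorem exists_eq {a : 𝟙_ C ⟶ X} (ha : IsHomAtom hC.biproducts a) : ∃ m, e m = a := by
  obtain ⟨k, hk, -⟩ := (he.complete _ _).1 (hC.comp_dagger_self_eq_one ha.1)
  exact ⟨k, (ha.2 _ (he.homLE_of_comp_dagger hC hk)).resolve_left (he.ne_zero hC k)⟩

/-- A basis is in bijection with the set of atoms. -/
noncomputable def equivAtom : M ≃ {a : 𝟙_ C ⟶ X // IsHomAtom hC.biproducts a} :=
  Equiv.ofBijective (fun m => ⟨e m, he.isHomAtom hC m⟩)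
    ⟨fun i j h => (he.orthonormal i j).1 <| by
      rw [show e i = e j from Subtype.ext_iff.1 h]
      exact (he.orthonormal j j).2 rfl,
    fun a => (he.exists_eq hC a.2).imp fun _ h => Subtype.ext h⟩

end IsPointBasis

theorem AtomObj.ext {h : HasDaggerBiproducts C} {X : C} {a b : AtomObj h X}
    (hab : a.mor = b.mor) : a = b := Subtype.ext hab

include hC in
theorem isPointBasis_unit : IsPointBasis fun _ : PUnit.{v + 1} => 𝟙 (𝟙_ C) where
  orthonormal _ _ := by simp [DaggerCategory.dagger_id]
  complete x w := by simp [DaggerCategory.dagger_id, hC.scalar_comp_eq_one_iff]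

include hC in
theorem DaggerBiproduct.isPointBasis {M : Type v} (B : DaggerBiproduct fun _ : M => 𝟙_ C) :
    IsPointBasis B.bicone.ι where
  orthonormal i j := by
    rw [← B.π_eq]
    by_cases h : i = j
    · subst h; simp
    · simpa [h] using hC.id_unit_ne_zero.symm
  complete x w := by
    -- The matrix entries of this resolution of the identity are the completeness condition.
    have hid : homSum hC.biproducts (fun m => B.bicone.π m ≫ B.bicone.ι m) = 𝟙 _ := by
      refine B.hom_ext' fun j => ?_
      rw [comp_homSum, homSum_single _ _ j] <;> simp +contextual [Ne.symm]
    have := hC.homSum_eq_one_iff (fun m => B.bicone.π m ≫ B.bicone.ι m) x w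
    rw [hid, Category.id_comp] at this
    rw [this]
    refine exists_congr fun m => ?_
    rw [← B.π_eq, Category.assoc, ← Category.assoc, hC.scalar_comp_eq_one_iff]

variable [SymmetricCategory C] [IsDaggerCompactClosed C]

/-- By atomicity, points that meet have a common atom below them; for two atoms this forces
equality. -/
theorem isPointBasis_atom (X : C) :
    IsPointBasis fun a : AtomObj hC.biproducts X => a.mor := by
  have hle {a x : 𝟙_ C ⟶ X} (ha : IsHomAtom hC.biproducts a) (h : x ≫ a‡ = 𝟙 (𝟙_ C)) :
      homLE hC.biproducts a x := by
    obtain ⟨z, hz, hzx, hza⟩ := hC.exists_common_lower_bound h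
    exact (ha.2 z hza).resolve_left hz ▸ hzx
  refine ⟨fun a b => ⟨fun h => ?_, ?_⟩, fun x w => ⟨fun h => ?_, ?_⟩⟩
  · obtain ⟨z, hz, hza, hzb⟩ := hC.exists_common_lower_bound h
    exact AtomObj.ext (((a.2.2 z hza).resolve_left hz).symm.trans ((b.2.2 z hzb).resolve_left hz))
  · rintro rfl
    exact hC.comp_dagger_self_eq_one a.2.1
  · obtain ⟨z, hz, hzx, hzw⟩ := hC.exists_common_lower_bound h
    obtain ⟨a, ha, haz⟩ := hC.exists_isHomAtom_homLE hz
    have h₁ := hC.point_homLE_iff.1 haz _ (hC.comp_dagger_self_eq_one ha.1)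
    refine ⟨⟨a, ha⟩, hC.point_homLE_iff.1 hzx _ h₁, ?_⟩
    have h₂ := hC.point_homLE_iff.1 hzw _ h₁
    rwa [hC.comp_dagger_symm] at h₂
  · rintro ⟨a, h₁, h₂⟩
    exact hC.point_homLE_iff.1 (hle a.2 h₁) _ h₂

theorem atom_comp_dagger_eq_one_iff {X : C} (a b : AtomObj hC.biproducts X) :
    a.mor ≫ (b.mor)‡ = 𝟙 (𝟙_ C) ↔ a = b :=
  (isPointBasis_atom hC X).orthonormal a b

/-- Preservation of composition is completeness of the atoms of the middle object, applied to `a.mor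
≫ r` and `c.mor ≫ s‡`. -/
theorem atomFunctorial : AtomFunctorial hC.biproducts where
  map_id X := by
    ext ⟨a, b⟩
    change a.mor ≫ 𝟙 X ≫ (b.mor)‡ = 𝟙 (𝟙_ C) ↔ a = b
    rw [Category.id_comp, atom_comp_dagger_eq_one_iff hC]
  map_comp {X Y Z} r s := by
    ext ⟨a, c⟩
    change a.mor ≫ (r ≫ s) ≫ (c.mor)‡ = 𝟙 (𝟙_ C) ↔
      ∃ b : AtomObj hC.biproducts Y, a.mor ≫ r ≫ (b.mor)‡ = 𝟙 (𝟙_ C) ∧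
        b.mor ≫ s ≫ (c.mor)‡ = 𝟙 (𝟙_ C)
    have := (isPointBasis_atom hC Y).complete (a.mor ≫ r) (c.mor ≫ s‡)
    simpa [DaggerCategory.dagger_comp, DaggerCategory.dagger_dagger] using this

theorem RelCat.isDaggerIso_isoOfEquiv {X Y : Type v} (e : X ≃ Y) :
    IsDaggerIso (RelCat.isoOfEquiv e).hom :=
  ⟨(RelCat.isoOfEquiv e).hom_inv_id, (RelCat.isoOfEquiv e).inv_hom_id⟩

/-- Each rank-one summand has a single nonzero entry on atoms, so summing over `R` realises `R`;
this gives fullness. -/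
theorem atom_comp_homSum_eq_one_iff {X Y : C}
    (R : Set (AtomObj hC.biproducts X × AtomObj hC.biproducts Y))
    (a : AtomObj hC.biproducts X) (b : AtomObj hC.biproducts Y) :
    a.mor ≫ homSum hC.biproducts (fun p : R => (p.1.1.mor)‡ ≫ p.1.2.mor) ≫ (b.mor)‡ =
      𝟙 (𝟙_ C) ↔ (a, b) ∈ R := by
  have h (p : AtomObj hC.biproducts X × AtomObj hC.biproducts Y) :
      a.mor ≫ ((p.1.mor)‡ ≫ p.2.mor) ≫ (b.mor)‡ = 𝟙 (𝟙_ C) ↔ a = p.1 ∧ p.2 = b := by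
    rw [Category.assoc, ← Category.assoc, hC.scalar_comp_eq_one_iff,
      atom_comp_dagger_eq_one_iff hC, atom_comp_dagger_eq_one_iff hC]
  rw [hC.homSum_eq_one_iff]
  constructor
  · rintro ⟨⟨⟨a', b'⟩, hp⟩, h'⟩
    obtain ⟨rfl, rfl⟩ := (h _).1 h'
    exact hp
  · exact fun hp => ⟨⟨(a, b), hp⟩, (h _).2 ⟨rfl, rfl⟩⟩

theorem isDaggerEquivalence_atomFunctor :
    IsDaggerEquivalence (atomFunctor hC.biproducts (atomFunctorial hC)) where
  isDagger {X Y} f := by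
    ext ⟨b, a⟩
    change b.mor ≫ f‡ ≫ (a.mor)‡ = 𝟙 (𝟙_ C) ↔ a.mor ≫ f ≫ (b.mor)‡ = 𝟙 (𝟙_ C)
    rw [← hC.scalar_dagger (a.mor ≫ f ≫ (b.mor)‡), DaggerCategory.dagger_comp,
      DaggerCategory.dagger_comp, DaggerCategory.dagger_dagger, Category.assoc]
  faithful := ⟨fun {X Y} r s h => by
    -- Completeness on both sides recovers all entries from those at atoms.
    have key (t : X ⟶ Y) (x : 𝟙_ C ⟶ X) (y : 𝟙_ C ⟶ Y) : x ≫ t ≫ y‡ = 𝟙 (𝟙_ C) ↔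
        ∃ (a : AtomObj hC.biproducts X) (b : AtomObj hC.biproducts Y),
          x ≫ (a.mor)‡ = 𝟙 (𝟙_ C) ∧ a.mor ≫ t ≫ (b.mor)‡ = 𝟙 (𝟙_ C) ∧
            b.mor ≫ y‡ = 𝟙 (𝟙_ C) := by
      have h₁ := (isPointBasis_atom hC X).complete x (y ≫ t‡)
      rw [DaggerCategory.dagger_comp, DaggerCategory.dagger_dagger] at h₁
      rw [h₁]
      refine exists_congr fun a => ?_
      have h₂ := (isPointBasis_atom hC Y).complete (a.mor ≫ t) y
      simp only [Category.assoc] at h₂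
      rw [h₂]
      exact ⟨fun ⟨h, b, hb⟩ => ⟨b, h, hb⟩, fun ⟨b, h, hb⟩ => ⟨h, b, hb⟩⟩
    have hrs (a : AtomObj hC.biproducts X) (b : AtomObj hC.biproducts Y) :
        a.mor ≫ r ≫ (b.mor)‡ = 𝟙 (𝟙_ C) ↔ a.mor ≫ s ≫ (b.mor)‡ = 𝟙 (𝟙_ C) :=
      Set.ext_iff.1 (congrArg RelCat.Hom.rel h) (a, b)
    rw [hC.ext_iff]
    intro x y
    rw [key, key]
    simp only [hrs]⟩
  full := ⟨fun {X Y} R => by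
    let R' : Set (AtomObj hC.biproducts X × AtomObj hC.biproducts Y) := R.rel
    refine ⟨homSum hC.biproducts fun p : R' => (p.1.1.mor)‡ ≫ p.1.2.mor, ?_⟩
    ext ⟨a, b⟩
    exact atom_comp_homSum_eq_one_iff hC R' a b⟩
  essSurj M := by
    -- The injections of a biproduct of `M` copies of `I` are a basis, so its atoms are in bijection
    -- with `M`.
    obtain ⟨B⟩ := hC.biproducts M fun _ => 𝟙_ C
    exact ⟨_, _, RelCat.isDaggerIso_isoOfEquiv ((B.isPointBasis hC).equivAtom hC).symm⟩

end Basis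

/-! ### Tensor products of points -/

section PointTensor

variable {C : Type u} [Category.{v} C] [MonoidalCategory C]

/-- The element `(x ⊗ y) ∘ λ_I⁻¹` of `C(I, X ⊗ Y)`. -/
def pointTensor {X Y : C} (x : 𝟙_ C ⟶ X) (y : 𝟙_ C ⟶ Y) : 𝟙_ C ⟶ X ⊗ Y :=
  (λ_ (𝟙_ C)).inv ≫ (x ⊗ₘ y)

theorem pointTensor_associator {X Y Z : C} (x : 𝟙_ C ⟶ X) (y : 𝟙_ C ⟶ Y) (z : 𝟙_ C ⟶ Z) :
    pointTensor (pointTensor x y) z ≫ (α_ X Y Z).hom = pointTensor x (pointTensor y z) := by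
  simp only [pointTensor]
  rw [MonoidalCategory.tensorHom_def ((λ_ (𝟙_ C)).inv ≫ (x ⊗ₘ y)) z,
    MonoidalCategory.tensorHom_def x ((λ_ (𝟙_ C)).inv ≫ (y ⊗ₘ z)),
    MonoidalCategory.tensorHom_def, MonoidalCategory.tensorHom_def]
  monoidal

theorem pointTensor_leftUnitor {X : C} (x : 𝟙_ C ⟶ X) :
    pointTensor (𝟙 _) x ≫ (λ_ X).hom = x := by
  simp [pointTensor]

theorem pointTensor_rightUnitor {X : C} (x : 𝟙_ C ⟶ X) :
    pointTensor x (𝟙 _) ≫ (ρ_ X).hom = x := by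
  simp [pointTensor, unitors_inv_equal]

theorem pointTensor_braiding [BraidedCategory C] {X Y : C} (x : 𝟙_ C ⟶ X) (y : 𝟙_ C ⟶ Y) :
    pointTensor x y ≫ (β_ X Y).hom = pointTensor y x := by
  simp [pointTensor, unitors_inv_equal]

variable [DaggerCategory C] [SymmetricCategory C] [IsDaggerSymmetricMonoidal C]

theorem pointTensor_comp_dagger {X Y X' Y' : C} (x : 𝟙_ C ⟶ X) (y : 𝟙_ C ⟶ Y) (f : X ⟶ X')
    (g : Y ⟶ Y') (x' : 𝟙_ C ⟶ X') (y' : 𝟙_ C ⟶ Y') :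
    pointTensor x y ≫ (f ⊗ₘ g) ≫ (pointTensor x' y')‡ = (x ≫ f ≫ x'‡) ≫ (y ≫ g ≫ y'‡) := by
  -- Up to unitors, the tensor product of scalars is their composite.
  have h (s t : 𝟙_ C ⟶ 𝟙_ C) : (λ_ (𝟙_ C)).inv ≫ (s ⊗ₘ t) ≫ (λ_ (𝟙_ C)).hom = s ≫ t := by
    rw [MonoidalCategory.tensorHom_def]
    simp [unitors_equal, unitors_inv_equal]
  rw [← h]
  simp [pointTensor, DaggerCategory.dagger_comp,
    IsDaggerIso.dagger_inv (IsDaggerSymmetricMonoidal.leftUnitor (𝟙_ C)),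
    IsDaggerSymmetricMonoidal.dagger_tensorHom]

end PointTensor

/-! ### The functor of atoms is strong symmetric monoidal -/

section Monoidal

variable {C : Type u} [Category.{v} C] [DaggerCategory C] [HasZeroMorphisms C]
  [MonoidalCategory C] (hC : RelAxioms C)

theorem IsPointBasis.homSum_eq_id {M : Type v} {X : C} {e : M → (𝟙_ C ⟶ X)}
    (he : IsPointBasis e) : homSum hC.biproducts (fun m => (e m)‡ ≫ e m) = 𝟙 X := by
  rw [hC.ext_iff]
  intro x y
  rw [hC.homSum_eq_one_iff, Category.id_comp, he.complete]
  refine exists_congr fun m => ?_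
  rw [Category.assoc, ← Category.assoc, hC.scalar_comp_eq_one_iff]

variable [SymmetricCategory C] [IsDaggerCompactClosed C]

include hC in
theorem pointTensor_comp_dagger_eq_one_iff {X Y X' Y' : C} (x : 𝟙_ C ⟶ X) (y : 𝟙_ C ⟶ Y)
    (f : X ⟶ X') (g : Y ⟶ Y') (x' : 𝟙_ C ⟶ X') (y' : 𝟙_ C ⟶ Y') :
    pointTensor x y ≫ (f ⊗ₘ g) ≫ (pointTensor x' y')‡ = 𝟙 (𝟙_ C) ↔
      x ≫ f ≫ x'‡ = 𝟙 (𝟙_ C) ∧ y ≫ g ≫ y'‡ = 𝟙 (𝟙_ C) := by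
  rw [pointTensor_comp_dagger, hC.scalar_comp_eq_one_iff]

include hC in
theorem IsPointBasis.tensor {M N : Type v} {X Y : C} {e : M → (𝟙_ C ⟶ X)}
    {e' : N → (𝟙_ C ⟶ Y)} (he : IsPointBasis e) (he' : IsPointBasis e') :
    IsPointBasis fun p : M × N => pointTensor (e p.1) (e' p.2) where
  orthonormal p q := by
    have := pointTensor_comp_dagger_eq_one_iff hC (e p.1) (e' p.2) (𝟙 X) (𝟙 Y) (e q.1) (e' q.2)
    rw [id_tensorHom_id, Category.id_comp, Category.id_comp, Category.id_comp, he.orthonormal,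
      he'.orthonormal] at this
    rw [this, Prod.ext_iff]
  complete x w := by
    -- Tensoring preserves sums in each variable, so the resolutions of the two identities tensor to
    -- one of the identity of `X ⊗ Y`.
    have hid : homSum hC.biproducts (fun m => homSum hC.biproducts fun n =>
        ((e m)‡ ≫ e m) ⊗ₘ ((e' n)‡ ≫ e' n)) = 𝟙 (X ⊗ Y) := by
      simp_rw [MonoidalCategory.tensorHom_def]
      simp_rw [← comp_homSum, ← whiskerLeft_homSum]
      rw [he'.homSum_eq_id hC]
      simp_rw [MonoidalCategory.whiskerLeft_id, Category.comp_id]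
      rw [← homSum_whiskerRight, he.homSum_eq_id hC, MonoidalCategory.id_whiskerRight]
    rw [← Category.id_comp (w‡), ← hid, hC.homSum_eq_one_iff, Prod.exists]
    refine exists_congr fun m => ?_
    rw [hC.homSum_eq_one_iff]
    refine exists_congr fun n => ?_
    have : ((e m)‡ ≫ e m) ⊗ₘ ((e' n)‡ ≫ e' n) =
        (pointTensor (e m) (e' n))‡ ≫ pointTensor (e m) (e' n) := by
      simp [pointTensor, DaggerCategory.dagger_comp,
        IsDaggerIso.dagger_inv (IsDaggerSymmetricMonoidal.leftUnitor (𝟙_ C)),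
        IsDaggerSymmetricMonoidal.dagger_tensorHom]
    rw [this, Category.assoc, ← Category.assoc x, hC.scalar_comp_eq_one_iff, hid,
      Category.id_comp]

theorem isPointBasis_atom_tensor (X Y : C) :
    IsPointBasis fun p : AtomObj hC.biproducts X × AtomObj hC.biproducts Y =>
      pointTensor p.1.mor p.2.mor :=
  (isPointBasis_atom hC X).tensor hC (isPointBasis_atom hC Y)

/-- The functor of atoms. -/
noncomputable abbrev RelAxioms.atomFunctor : C ⥤ RelCat.{v} :=
  _root_.atomFunctor hC.biproducts (atomFunctorial hC)

/-- The unit comparison of the functor of atoms. -/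
noncomputable def atomUnitIso : 𝟙_ RelCat.{v} ≅ hC.atomFunctor.obj (𝟙_ C) :=
  RelCat.isoOfEquiv ((isPointBasis_unit hC).equivAtom hC)

/-- The tensor comparison of the functor of atoms. -/
noncomputable def atomTensorIso (X Y : C) :
    hC.atomFunctor.obj X ⊗ hC.atomFunctor.obj Y ≅ hC.atomFunctor.obj (X ⊗ Y) :=
  RelCat.isoOfEquiv ((isPointBasis_atom_tensor hC X Y).equivAtom hC)

theorem atomUnitIso_hom : (atomUnitIso hC).hom = RelCat.Hom.ofRel
    {p : 𝟙_ RelCat.{v} × AtomObj hC.biproducts (𝟙_ C) | p.2.mor = 𝟙 (𝟙_ C)} := by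
  ext ⟨x, a⟩
  exact ⟨fun h => (Subtype.ext_iff.1 h).symm, fun h => Subtype.ext h.symm⟩

theorem atomTensorIso_hom (X Y : C) : (atomTensorIso hC X Y).hom = RelCat.Hom.ofRel
    {p : (AtomObj hC.biproducts X × AtomObj hC.biproducts Y) × AtomObj hC.biproducts (X ⊗ Y) |
      p.2.mor = pointTensor p.1.1.mor p.1.2.mor} := by
  ext ⟨x, a⟩
  exact ⟨fun h => (Subtype.ext_iff.1 h).symm, fun h => Subtype.ext h.symm⟩

/-- The atom `x ⊗ y`. -/
def AtomObj.tensor {X Y : C} (x : AtomObj hC.biproducts X) (y : AtomObj hC.biproducts Y) :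
    AtomObj hC.biproducts (X ⊗ Y) :=
  ⟨pointTensor x.mor y.mor, (isPointBasis_atom_tensor hC X Y).isHomAtom hC (x, y)⟩

theorem AtomObj.exists_tensor_eq {X Y : C} (a : AtomObj hC.biproducts (X ⊗ Y)) :
    ∃ (x : AtomObj hC.biproducts X) (y : AtomObj hC.biproducts Y),
      a.mor = pointTensor x.mor y.mor := by
  obtain ⟨⟨x, y⟩, h⟩ := (isPointBasis_atom_tensor hC X Y).exists_eq hC a.2
  exact ⟨x, y, h.symm⟩

/-- The value of the functor of atoms at a morphism that sends atoms to atoms. -/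
theorem atomMap_mem_iff {X Y : C} {r : X ⟶ Y} {a : AtomObj hC.biproducts X}
    {b c : AtomObj hC.biproducts Y} (h : a.mor ≫ r = c.mor) :
    a.mor ≫ r ≫ (b.mor)‡ = 𝟙 (𝟙_ C) ↔ b.mor = c.mor := by
  rw [← Category.assoc, h, atom_comp_dagger_eq_one_iff hC]
  exact ⟨fun h => h ▸ rfl, fun h => (AtomObj.ext h).symm⟩

/-- The comparison isomorphisms make the functor of atoms strong monoidal. -/
noncomputable def atomCoreMonoidal : hC.atomFunctor.CoreMonoidal where
  εIso := atomUnitIso hC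
  μIso := atomTensorIso hC
  μIso_hom_natural_left {X Y} f X' := by
    rw [atomTensorIso_hom, atomTensorIso_hom]
    ext ⟨⟨a, b⟩, c⟩
    change AtomObj hC.biproducts X at a
    change AtomObj hC.biproducts X' at b
    change AtomObj hC.biproducts (Y ⊗ X') at c
    have key (a' : AtomObj hC.biproducts Y) (b' : AtomObj hC.biproducts X') :=
      pointTensor_comp_dagger_eq_one_iff hC a.mor b.mor f (𝟙 X') a'.mor b'.mor
    simp only [tensorHom_id, Category.id_comp, atom_comp_dagger_eq_one_iff hC] at key
    constructor
    · rintro ⟨⟨a', b'⟩, ⟨h₁, h₂⟩, h₃⟩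
      refine ⟨AtomObj.tensor hC a b, rfl, ?_⟩
      change AtomObj.mor c = _ at h₃
      change pointTensor a.mor b.mor ≫ (f ▷ X') ≫ (AtomObj.mor c)‡ = 𝟙 (𝟙_ C)
      rw [h₃]
      exact (key a' b').2 ⟨h₁, h₂⟩
    · rintro ⟨d, h₁, h₂⟩
      obtain ⟨a', b', h₃⟩ := AtomObj.exists_tensor_eq hC c
      change AtomObj.mor d = _ at h₁
      change AtomObj.mor d ≫ (f ▷ X') ≫ (AtomObj.mor c)‡ = 𝟙 (𝟙_ C) at h₂
      rw [h₁, h₃] at h₂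
      exact ⟨(a', b'), (key a' b').1 h₂, h₃⟩
  μIso_hom_natural_right {X Y} X' f := by
    rw [atomTensorIso_hom, atomTensorIso_hom]
    ext ⟨⟨a, b⟩, c⟩
    change AtomObj hC.biproducts X' at a
    change AtomObj hC.biproducts X at b
    change AtomObj hC.biproducts (X' ⊗ Y) at c
    have key (a' : AtomObj hC.biproducts X') (b' : AtomObj hC.biproducts Y) :=
      pointTensor_comp_dagger_eq_one_iff hC a.mor b.mor (𝟙 X') f a'.mor b'.mor
    simp only [id_tensorHom, Category.id_comp, atom_comp_dagger_eq_one_iff hC] at key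
    constructor
    · rintro ⟨⟨a', b'⟩, ⟨h₁, h₂⟩, h₃⟩
      refine ⟨AtomObj.tensor hC a b, rfl, ?_⟩
      change AtomObj.mor c = _ at h₃
      change pointTensor a.mor b.mor ≫ (X' ◁ f) ≫ (AtomObj.mor c)‡ = 𝟙 (𝟙_ C)
      rw [h₃]
      exact (key a' b').2 ⟨h₁, h₂⟩
    · rintro ⟨d, h₁, h₂⟩
      obtain ⟨a', b', h₃⟩ := AtomObj.exists_tensor_eq hC c
      change AtomObj.mor d = _ at h₁
      change AtomObj.mor d ≫ (X' ◁ f) ≫ (AtomObj.mor c)‡ = 𝟙 (𝟙_ C) at h₂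
      rw [h₁, h₃] at h₂
      exact ⟨(a', b'), (key a' b').1 h₂, h₃⟩
  associativity X Y Z := by
    simp only [atomTensorIso_hom]
    ext ⟨⟨⟨a, b⟩, c⟩, d⟩
    change AtomObj hC.biproducts X at a
    change AtomObj hC.biproducts Y at b
    change AtomObj hC.biproducts Z at c
    change AtomObj hC.biproducts (X ⊗ Y ⊗ Z) at d
    -- The associator carries the atom `(a ⊗ b) ⊗ c` to `a ⊗ (b ⊗ c)`, so both composites relate the
    -- triple to that atom alone.
    have key := atomMap_mem_iff hC (r := (α_ X Y Z).hom) (b := d)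
      (a := AtomObj.tensor hC (AtomObj.tensor hC a b) c)
      (c := AtomObj.tensor hC a (AtomObj.tensor hC b c)) (pointTensor_associator _ _ _)
    constructor
    · rintro ⟨⟨t, c'⟩, ⟨h₁, h₂⟩, w, h₃, h₄⟩
      obtain rfl : c = c' := h₂
      obtain rfl : t = AtomObj.tensor hC a b := AtomObj.ext h₁
      obtain rfl : w = AtomObj.tensor hC (AtomObj.tensor hC a b) c := AtomObj.ext h₃
      exact ⟨(a, b, c), rfl, (a, AtomObj.tensor hC b c), ⟨rfl, rfl⟩, key.1 h₄⟩
    · rintro ⟨⟨a', b', c'⟩, h₁, ⟨a'', t⟩, ⟨h₂, h₃⟩, h₄⟩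
      cases (show (a, b, c) = (a', b', c') from h₁)
      obtain rfl : a = a'' := h₂
      obtain rfl : t = AtomObj.tensor hC b c := AtomObj.ext h₃
      exact ⟨(AtomObj.tensor hC a b, c), ⟨rfl, rfl⟩, AtomObj.tensor hC (AtomObj.tensor hC a b) c,
        rfl, key.2 h₄⟩
  left_unitality X := by
    rw [atomTensorIso_hom, atomUnitIso_hom]
    ext ⟨⟨u, a⟩, d⟩
    change AtomObj hC.biproducts X at a
    change AtomObj hC.biproducts X at d
    let i : AtomObj hC.biproducts (𝟙_ C) := ⟨𝟙 _, (isPointBasis_unit hC).isHomAtom hC PUnit.unit⟩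
    have key := atomMap_mem_iff hC (r := (λ_ X).hom) (b := d)
      (a := AtomObj.tensor hC i a) (c := a) (pointTensor_leftUnitor _)
    constructor
    · intro h
      obtain rfl : a = d := h
      exact ⟨(i, a), ⟨rfl, rfl⟩, AtomObj.tensor hC i a, rfl, key.2 rfl⟩
    · rintro ⟨⟨j, a'⟩, ⟨h₁, h₂⟩, w, h₃, h₄⟩
      obtain rfl : a = a' := h₂
      obtain rfl : j = i := AtomObj.ext h₁
      obtain rfl : w = AtomObj.tensor hC i a := AtomObj.ext h₃
      exact (AtomObj.ext (key.1 h₄)).symm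
  right_unitality X := by
    rw [atomTensorIso_hom, atomUnitIso_hom]
    ext ⟨⟨a, u⟩, d⟩
    change AtomObj hC.biproducts X at a
    change AtomObj hC.biproducts X at d
    let i : AtomObj hC.biproducts (𝟙_ C) := ⟨𝟙 _, (isPointBasis_unit hC).isHomAtom hC PUnit.unit⟩
    have key := atomMap_mem_iff hC (r := (ρ_ X).hom) (b := d)
      (a := AtomObj.tensor hC a i) (c := a) (pointTensor_rightUnitor _)
    constructor
    · intro h
      obtain rfl : a = d := h
      exact ⟨(a, i), ⟨rfl, rfl⟩, AtomObj.tensor hC a i, rfl, key.2 rfl⟩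
    · rintro ⟨⟨a', j⟩, ⟨h₂, h₁⟩, w, h₃, h₄⟩
      obtain rfl : a = a' := h₂
      obtain rfl : j = i := AtomObj.ext h₁
      obtain rfl : w = AtomObj.tensor hC a i := AtomObj.ext h₃
      exact (AtomObj.ext (key.1 h₄)).symm

/-- The comparison isomorphisms make the functor of atoms strong symmetric monoidal. -/
@[reducible]
noncomputable def atomBraided : hC.atomFunctor.Braided where
  toMonoidal := (atomCoreMonoidal hC).toMonoidal
  braided X Y := by
    change (atomTensorIso hC X Y).hom ≫ _ = _ ≫ (atomTensorIso hC Y X).hom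
    rw [atomTensorIso_hom, atomTensorIso_hom]
    ext ⟨⟨a, b⟩, d⟩
    change AtomObj hC.biproducts X at a
    change AtomObj hC.biproducts Y at b
    change AtomObj hC.biproducts (Y ⊗ X) at d
    have key := atomMap_mem_iff hC (r := (β_ X Y).hom) (b := d)
      (a := AtomObj.tensor hC a b) (c := AtomObj.tensor hC b a) (pointTensor_braiding _ _)
    constructor
    · rintro ⟨w, h₁, h₂⟩
      obtain rfl : w = AtomObj.tensor hC a b := AtomObj.ext h₁
      exact ⟨(b, a), rfl, key.1 h₂⟩
    · rintro ⟨⟨b', a'⟩, h₁, h₂⟩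
      cases (show (b, a) = (b', a') from h₁)
      exact ⟨AtomObj.tensor hC a b, rfl, key.2 h₂⟩

theorem isAtomMonoidalDaggerEquivalence :
    IsAtomMonoidalDaggerEquivalence hC.biproducts (atomFunctorial hC) where
  daggerEquivalence := isDaggerEquivalence_atomFunctor hC
  monoidal := ⟨atomBraided hC, atomUnitIso_hom hC, RelCat.isDaggerIso_isoOfEquiv _,
    atomTensorIso_hom hC, fun _ _ => RelCat.isDaggerIso_isoOfEquiv _⟩

end Monoidal

/-! ### Sets and relations satisfy the axioms -/

section Rel

theorem IsDaggerMono.mono {C : Type u} [Category.{v} C] [DaggerCategory C] {X Y : C} {m : X ⟶ Y}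
    (hm : IsDaggerMono m) : Mono m :=
  ⟨fun g g' h => by
    have := congrArg (· ≫ m‡) h
    simpa only [Category.assoc, show m ≫ m‡ = 𝟙 X from hm, Category.comp_id] using this⟩

namespace RelCat

theorem hom_ext_iff {X Y : RelCat.{v}} {r s : X ⟶ Y} :
    r = s ↔ ∀ (x : X) (y : Y), (x, y) ∈ r.rel ↔ (x, y) ∈ s.rel :=
  ⟨fun h _ _ => h ▸ Iff.rfl, fun h => by ext ⟨x, y⟩; exact h x y⟩

theorem not_mem_zero {X Y : RelCat.{v}} {x : X} {y : Y} : (x, y) ∉ (0 : X ⟶ Y).rel := fun h => h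

instance isDaggerSymmetricMonoidal : IsDaggerSymmetricMonoidal RelCat.{v} where
  dagger_tensorHom _ _ := rfl
  associator _ _ _ := isDaggerIso_isoOfEquiv _
  leftUnitor _ := isDaggerIso_isoOfEquiv _
  rightUnitor _ := isDaggerIso_isoOfEquiv _
  braiding _ _ := isDaggerIso_isoOfEquiv _

/-- Every set is dual to itself. -/
@[reducible]
def exactPairing (X : RelCat.{v}) : ExactPairing X X where
  coevaluation' := RelCat.Hom.ofRel {p : 𝟙_ RelCat.{v} × @Prod.{v, v} X X | p.2.1 = p.2.2}
  evaluation' := RelCat.Hom.ofRel {p : @Prod.{v, v} X X × 𝟙_ RelCat.{v} | p.1.1 = p.1.2}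
  coevaluation_evaluation' := by
    ext ⟨⟨x, u⟩, ⟨u', y⟩⟩
    constructor
    · rintro ⟨⟨a, b, c⟩, ⟨h₁, h₂⟩, ⟨⟨⟨d, e⟩, f⟩, h₃, ⟨h₄, h₅⟩⟩⟩
      cases (show ((a, b), c) = ((d, e), f) from
        (Equiv.prodAssoc X X X).injective (show _ = _ from h₃.symm))
      have h₆ : y = x := (show c = y from h₅).symm.trans <| (show b = c from h₂).symm.trans <|
        (show a = b from h₄).symm.trans (show x = a from h₁).symm
      exact ⟨x, rfl, h₆⟩
    · rintro ⟨z, h₁, h₂⟩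
      cases (show x = z from h₁)
      cases (show y = x from h₂)
      exact ⟨(x, x, x), ⟨rfl, rfl⟩, ⟨((x, x), x), rfl, ⟨rfl, rfl⟩⟩⟩
  evaluation_coevaluation' := by
    ext ⟨⟨u, x⟩, ⟨y, u'⟩⟩
    constructor
    · rintro ⟨⟨⟨a, b⟩, c⟩, ⟨h₁, h₂⟩, ⟨⟨d, e, f⟩, h₃, ⟨h₄, h₅⟩⟩⟩
      cases (show (a, b, c) = (d, e, f) from h₃)
      have h₆ : y = x := (show a = y from h₄).symm.trans <| (show a = b from h₁).trans <|
        (show b = c from h₅).trans (show x = c from h₂).symm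
      exact ⟨x, rfl, h₆⟩
    · rintro ⟨z, h₁, h₂⟩
      cases (show x = z from h₁)
      cases (show y = x from h₂)
      exact ⟨((x, x), x), ⟨rfl, rfl⟩, ⟨(x, x, x), rfl, ⟨rfl, rfl⟩⟩⟩

instance isDaggerCompactClosed : IsDaggerCompactClosed RelCat.{v} where
  exists_dual X := ⟨X, exactPairing X, by
    ext ⟨⟨x, y⟩, u⟩
    constructor
    · intro h
      exact ⟨(y, x), rfl, Eq.symm h⟩
    · rintro ⟨⟨a, b⟩, h₁, h₂⟩
      cases (show (y, x) = (a, b) from h₁)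
      exact Eq.symm h₂⟩

/-- The disjoint union is a dagger biproduct of sets. -/
noncomputable def daggerBiproduct {M : Type v} (f : M → RelCat.{v}) : DaggerBiproduct f where
  bicone :=
    { pt := (Σ m, (f m : Type v) : Type v)
      π m := RelCat.Hom.ofRel {p : (Σ m, (f m : Type v)) × f m | p.1 = ⟨m, p.2⟩}
      ι m := RelCat.Hom.ofRel {p : f m × (Σ m, (f m : Type v)) | p.2 = ⟨m, p.1⟩}
      ι_π i j := by
        split_ifs with h
        · subst h
          ext ⟨x, y⟩
          constructor
          · rintro ⟨z, h₁, h₂⟩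
            have := h₁.symm.trans h₂
            exact eq_of_heq (Sigma.mk.inj this).2
          · rintro h
            cases (show x = y from h)
            exact ⟨⟨i, x⟩, rfl, rfl⟩
        · ext ⟨x, y⟩
          refine ⟨?_, fun h => h.elim⟩
          rintro ⟨z, h₁, h₂⟩
          exact (h (Sigma.mk.inj (h₁.symm.trans h₂)).1).elim }
  isBilimit :=
    { isLimit := Fan.IsLimit.mk _
        (fun s => RelCat.Hom.ofRel {p : s.pt × (Σ m, (f m : Type v)) |
          (p.1, p.2.2) ∈ (s.proj p.2.1).rel})
        (fun s m => by
          rw [hom_ext_iff]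
          intro x y
          constructor
          · rintro ⟨z, h₁, h₂⟩
            cases (show z = ⟨m, y⟩ from h₂)
            exact h₁
          · exact fun h => ⟨⟨m, y⟩, h, rfl⟩)
        (fun s r hr => by
          rw [hom_ext_iff]
          rintro x ⟨m, y⟩
          have := hom_ext_iff.1 (hr m) x y
          refine Iff.trans ⟨fun h => ?_, ?_⟩ this
          · exact ⟨⟨m, y⟩, h, rfl⟩
          · rintro ⟨z, h₁, h₂⟩
            cases (show z = ⟨m, y⟩ from h₂)
            exact h₁)
      isColimit := Cofan.IsColimit.mk _
        (fun s => RelCat.Hom.ofRel {p : (Σ m, (f m : Type v)) × s.pt |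
          (p.1.2, p.2) ∈ (s.inj p.1.1).rel})
        (fun s m => by
          rw [hom_ext_iff]
          intro x y
          constructor
          · rintro ⟨z, h₁, h₂⟩
            cases (show z = ⟨m, x⟩ from h₁)
            exact h₂
          · exact fun h => ⟨⟨m, x⟩, rfl, h⟩)
        (fun s r hr => by
          rw [hom_ext_iff]
          rintro ⟨m, x⟩ y
          have := hom_ext_iff.1 (hr m) x y
          refine Iff.trans ⟨fun h => ?_, ?_⟩ this
          · exact ⟨⟨m, x⟩, rfl, h⟩
          · rintro ⟨z, h₁, h₂⟩
            cases (show z = ⟨m, x⟩ from h₁)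
            exact h₂) }
  π_eq _ := rfl

/-- The set of elements not related to anything. -/
def kernelObj {X Y : RelCat.{v}} (r : X ⟶ Y) : RelCat.{v} :=
  {x : (X : Type v) // ∀ y : Y, (x, y) ∉ r.rel}

/-- The inclusion of the elements not related to anything. -/
def kernelι {X Y : RelCat.{v}} (r : X ⟶ Y) : kernelObj r ⟶ X :=
  RelCat.Hom.ofRel {p | p.1.1 = p.2}

theorem isDaggerMono_kernelι {X Y : RelCat.{v}} (r : X ⟶ Y) : IsDaggerMono (kernelι r) := by
  ext ⟨x, y⟩
  constructor
  · rintro ⟨z, h₁, h₂⟩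
    exact Subtype.ext ((show x.1 = z from h₁).trans (show y.1 = z from h₂).symm)
  · intro h
    cases (show x = y from h)
    exact ⟨x.1, rfl, rfl⟩

theorem isKernelOf_kernelι {X Y : RelCat.{v}} (r : X ⟶ Y) : IsKernelOf (kernelι r) r := by
  have : Mono (kernelι r) := (isDaggerMono_kernelι r).mono
  refine ⟨?_, ⟨KernelFork.IsLimit.ofι' _ _ fun {A} k hk =>
    ⟨RelCat.Hom.ofRel {p | (p.1, p.2.1) ∈ k.rel}, ?_⟩⟩⟩
  · rw [hom_ext_iff]
    intro x y
    refine ⟨?_, fun h => h.elim⟩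
    rintro ⟨z, h₁, h₂⟩
    cases (show x.1 = z from h₁)
    exact (x.2 y h₂).elim
  · rw [hom_ext_iff]
    intro a x
    constructor
    · rintro ⟨z, h₁, h₂⟩
      cases (show z.1 = x from h₂)
      exact h₁
    · exact fun h => ⟨⟨x, fun y hy => not_mem_zero ((hom_ext_iff.1 hk a y).1 ⟨x, h, hy⟩)⟩, h, rfl⟩

/-- The relation from the one-element set determined by an element. -/
def point {X : RelCat.{v}} (x : X) : 𝟙_ RelCat.{v} ⟶ X :=
  RelCat.Hom.ofRel {p | p.2 = x}

theorem mem_point_comp_iff {X Y : RelCat.{v}} (x : X) (r : X ⟶ Y) (y : Y) :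
    (PUnit.unit, y) ∈ (point x ≫ r).rel ↔ (x, y) ∈ r.rel := by
  constructor
  · rintro ⟨z, h₁, h₂⟩
    cases (show z = x from h₁)
    exact h₂
  · exact fun h => ⟨x, rfl, h⟩

theorem hom_ext_of_point {X Y : RelCat.{v}} {r s : X ⟶ Y}
    (h : ∀ x, point x ≫ r = point x ≫ s) : r = s := by
  rw [hom_ext_iff]
  intro x y
  have := mem_point_comp_iff x r y
  rw [h] at this
  exact this.symm.trans (mem_point_comp_iff x s y)

theorem scalar_eq_id {s : 𝟙_ RelCat.{v} ⟶ 𝟙_ RelCat.{v}} (hs : s ≠ 0) : s = 𝟙 _ := by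
  rw [hom_ext_iff]
  rintro ⟨⟩ ⟨⟩
  refine ⟨fun _ => rfl, fun _ => ?_⟩
  by_contra h
  refine hs (hom_ext_iff.2 ?_)
  rintro ⟨⟩ ⟨⟩
  exact ⟨fun h' => (h h').elim, fun h' => h'.elim⟩

theorem relAxioms : RelAxioms RelCat.{v} where
  biproducts _ f := ⟨daggerBiproduct f⟩
  kernels r := ⟨_, kernelι r, isKernelOf_kernelι r, isDaggerMono_kernelι r⟩
  jointlyEpic {A A' X} k k' hk hk' := by
    obtain ⟨-, W, r, hr⟩ := hk
    intro Y f g h h'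
    refine hom_ext_of_point fun x => ?_
    -- An element hit by `k` is annihilated by `r`, so its point factors through `k`; an element
    -- missed by `k` is annihilated by `k‡`, so its point factors through `k'`.
    obtain ⟨l, hl⟩ | ⟨l, hl⟩ : (∃ l, point x = l ≫ k) ∨ ∃ l, point x = l ≫ k' := by
      by_cases hx : ∃ a : A, (a, x) ∈ k.rel
      · obtain ⟨a, ha⟩ := hx
        refine .inl (hr.exists_fac _ (hom_ext_iff.2 fun u w => ?_))
        refine ⟨?_, fun h => h.elim⟩
        rintro ⟨z, h₁, h₂⟩
        cases (show z = x from h₁)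
        exact (hom_ext_iff.1 hr.condition a w).1 ⟨_, ha, h₂⟩
      · refine .inr (hk'.2.exists_fac _ (hom_ext_iff.2 fun u a => ?_))
        refine ⟨?_, fun h => h.elim⟩
        rintro ⟨z, h₁, h₂⟩
        cases (show z = x from h₁)
        exact (hx ⟨a, h₂⟩).elim
    · rw [hl, Category.assoc, h, Category.assoc]
    · rw [hl, Category.assoc, h', Category.assoc]
  unit_nonzero h :=
    not_mem_zero ((hom_ext_iff.1 ((IsZero.iff_id_eq_zero _).1 h) PUnit.unit PUnit.unit).1 rfl)
  scalar_invertible s hs := by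
    rw [scalar_eq_id hs]
    infer_instance
  separator := (isSeparator_def _).2 fun _ _ _ _ h => hom_ext_of_point fun _ => h _

end RelCat

end Rel

theorem theorem5 :
    (∀ (C : Type u) [Category.{v} C] [DaggerCategory C] [HasZeroMorphisms C]
        [MonoidalCategory C] [SymmetricCategory C] [IsDaggerCompactClosed C]
        (hC : RelAxioms C),
      ∃ hE : AtomFunctorial hC.biproducts,
        IsAtomMonoidalDaggerEquivalence hC.biproducts hE) ∧
    IsDaggerCompactClosed RelCat.{v} ∧ RelAxioms RelCat.{v} :=
  ⟨fun _ _ _ _ _ _ _ hC => ⟨_, isAtomMonoidalDaggerEquivalence hC⟩,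
    RelCat.isDaggerCompactClosed, RelCat.relAxioms⟩
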